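/- **Setting.** Let $\mathcal A$ be a finite set, $\Omega=\mathcal A^{\mathbb N}$ with $\mathbb N=\{1,2,\dots\}$, with the product $\sigma$-algebra and the left shift $\varphi(\omega)_j=\omega_{j+1}$. For a probability measure $\mathbb Q$ on $\Omega$ and a finite word $w=(w_1,\dots,w_t)$, write $\mathbb Q(w)=\mathbb Q(\{\omega:\omega_1=w_1,\dots,\omega_t=w_t\})$, and let $\mathbb Q_t$ be the law of $(\omega_1,\dots,\omega_t)$ on $\mathcal A^t$, so that $\mathbb Q_t(w)=\mathbb Q(w)$. Write $|w|$ for the length of $w$, and $\langle f,\mathbb Q\rangle=\int f\,d\mathbb Q$. Let $\mathbb P,\widehat{\mathbb P}$ be $\varphi$-invariant probability measures on $\Omega$ with $\mathbb P_t\ll\widehat{\mathbb P}_t$ for all $t\in\mathbb N$, and let $\sigma_t=\log\frac{d\mathbb P_t}{d\widehat{\mathbb P}_t}$, regarded as a ($\mathbb P$-almost surely defined) function of $\omega$ through $(\omega_1,\dots,\omega_t)$. **Assumption (SSD).** There are sequences $\tau_t\in\{0,1,2,\dots\}$ and $c_t\in[0,\infty)$ with $\tau_t/t\to0$ and $c_t/t\to0$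 as $t\to\infty$, such that for all $t\in\mathbb N$, all words $u$ of length $t$ and all finite words $v$ with $|v|\ge1$ there is a (possibly empty) word $\xi$ with $|\xi|\le\tau_t$ such that, for both $\mathbb P^\sharp=\mathbb P$ and $\mathbb P^\sharp=\widehat{\mathbb P}$ (with the same $\xi$), $$e^{-c_t}\,\mathbb P^\sharp(u)\,\mathbb P^\sharp(v)\le\mathbb P^\sharp(u\xi v)\le e^{c_t}\,\mathbb P^\sharp(u)\,\mathbb P^\sharp(v).$$ **Theorem (LDP for entropy production / Fluctuation Theorem).** Assume (SSD). With the convention $\log 0=-\infty$, the following hold. 1. For every $\alpha\in\mathbb R$ the limit $q(\alpha)=\lim_{t\to\infty}\frac1t\log\langle e^{\alpha\sigma_t},\mathbb P\rangle$ exists in $(-\infty,\infty]$, and $q$ is a closed proper convex function on $\mathbb R$ (convex, lower semicontinuous, not everywhere infinite). Moreover $q(0)=0$ and $q(-1)\le0$, and $q\le0$ on $[-1,0]$. 2. The sequence $(\frac1t\sigma_t)_{t\in\mathbb N}$ satisfies the (full) large deviation principle with a convex rate function $I:\mathbb R\to[0,\infty]$: $I$ is lower semicontinuous, and for every open $O\subset\mathbb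 R$ and every closed $\Gamma\subset\mathbb R$, $$\liminf_{t\to\infty}\tfrac1t\log\mathbb P\big(\tfrac1t\sigma_t\in O\big)\ge-\inf_{s\in O}I(s),\qquad \limsup_{t\to\infty}\tfrac1t\log\mathbb P\big(\tfrac1t\sigma_t\in\Gamma\big)\le-\inf_{s\in\Gamma}I(s).$$ Moreover $I$ is the Fenchel–Legendre transform of $q$: $I(s)=q^*(s)=\sup_{\alpha\in\mathbb R}(\alpha s-q(\alpha))$ for all $s\in\mathbb R$. (No finiteness of $q$ outside $[-1,0]$ is assumed.) 3. If $q$ is finite in a neighborhood of $0$, then $I$ is a good rate function, i.e. $\{s\in\mathbb R:I(s)\le a\}$ is compact for every $a\in\mathbb R$. 4. Suppose that $\widehat{\mathbb P}=\Theta\mathbb P$, i.e. $\widehat{\mathbb P}_t=\mathbb P_t\circ\theta_t$ for all $t\in\mathbb N$, where for some involution $u:\mathcal A\to\mathcal A$ either $\theta_t(w_1,\dots,w_t)=(u(w_1),\dots,u(w_t))$ for all $t$ and $w$, or $\theta_t(w_1,\dots,w_t)=(u(w_t),\dots,u(w_1))$ for all $t$ and $w$. Then $q(-\alpha)=q(\alpha-1)$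 for all $\alpha\in\mathbb R$, and $I(-s)=I(s)+s$ for all $s\in\mathbb R$. -/

import Mathlib

open MeasureTheory Filter Topology
open scoped ENNReal

namespace SymbolicLDP

/-- The left shift on the space `ℕ → A` of one-sided sequences. The letters are numbered from `0`,
so the first `t` letters of `ω` are `ω 0, …, ω (t - 1)`. -/
def shift {A : Type*} (ω : ℕ → A) : ℕ → A := fun j => ω (j + 1)

/-- The cylinder set of a finite word `w`: the sequences that begin with `w`. The cylinder of the
empty word is the whole space. -/
def wordCylinder {A : Type*} (w : List A) : Set (ℕ → A) :=
  {ω | ∀ (i : ℕ) (h : i < w.length), ω i = w[i]}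

/-- The probability `Q(w)` that a `Q`-random sequence begins with the word `w`. -/
noncomputable def wordProb {A : Type*} [MeasurableSpace A] (Q : Measure (ℕ → A)) (w : List A) : ℝ :=
  Q.real (wordCylinder w)

/-- The marginal `Q_t`, the law of the first `t` letters under `Q`. -/
noncomputable def marginal {A : Type*} [MeasurableSpace A] (Q : Measure (ℕ → A)) (t : ℕ) :
    Measure (Fin t → A) :=
  Q.map (fun ω (i : Fin t) => ω i)

/-- Selective symmetric decoupling of the pair `(P, P')`, with `c_t = o(t)` and `τ_t = o(t)`: any two
nonempty words `u` (of length `t`) and `v` can be joined by a word `ξ` of length at most `τ_t`,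
the same for both measures, so that `uξv` has probability comparable with the product of those of
`u` and `v`. -/
def SelectiveSymmetricDecoupling {A : Type*} [MeasurableSpace A] (P P' : Measure (ℕ → A)) : Prop :=
  ∃ (τ : ℕ → ℕ) (c : ℕ → ℝ),
    (∀ t, 0 ≤ c t) ∧
    Tendsto (fun t : ℕ => c t / t) atTop (𝓝 0) ∧
    Tendsto (fun t : ℕ => (τ t : ℝ) / t) atTop (𝓝 0) ∧
    ∀ t : ℕ, 1 ≤ t → ∀ u v : List A, u.length = t → 1 ≤ v.length →
      ∃ ξ : List A, ξ.length ≤ τ t ∧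
        ∀ Q ∈ ({P, P'} : Set (Measure (ℕ → A))),
          Real.exp (-c t) * (wordProb Q u * wordProb Q v) ≤ wordProb Q (u ++ ξ ++ v) ∧
          wordProb Q (u ++ ξ ++ v) ≤ Real.exp (c t) * (wordProb Q u * wordProb Q v)

/-- The entropy production observable `σ_t = log (dP_t / dP'_t)`, as a function of the sequence
(through its first `t` letters). -/
noncomputable def entropyProduction {A : Type*} [MeasurableSpace A] (P P' : Measure (ℕ → A)) (t : ℕ)
    (ω : ℕ → A) : ℝ :=
  llr (marginal P t) (marginal P' t) (fun i : Fin t => ω i)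

/-- A family of maps on words of each length which applies an involution of the alphabet letter by
letter, either keeping the order of the letters for every length or reversing it for every
length. -/
def IsInvolutionFamily {A : Type*} (θ : ∀ t : ℕ, (Fin t → A) → (Fin t → A)) : Prop :=
  ∃ u : A → A, Function.Involutive u ∧
    ((∀ t w, θ t w = fun i => u (w i)) ∨ (∀ t w, θ t w = fun i => u (w i.rev)))

/-- `P' = Θ P`: the marginals of `P'` are `P_t ∘ θ_t`. (A measure on sequences is determined by
its marginals.) -/
def IsTransformOf {A : Type*} [MeasurableSpace A] (θ : ∀ t : ℕ, (Fin t → A) → (Fin t → A))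
    (P' P : Measure (ℕ → A)) : Prop :=
  ∀ (t : ℕ) (w : Fin t → A), marginal P' t {w} = marginal P t {θ t w}

/-- Convexity of an extended real function on the line: its epigraph is convex. -/
def IsConvexFun (f : ℝ → EReal) : Prop :=
  Convex ℝ {p : ℝ × ℝ | f p.1 ≤ (p.2 : EReal)}

/-- Closed proper convex functions with values in `(-∞, ∞]`. -/
structure IsClosedProperConvex (f : ℝ → EReal) : Prop where
  convex : IsConvexFun f
  lowerSemicontinuous : LowerSemicontinuous f
  ne_bot : ∀ x, f x ≠ ⊥
  exists_ne_top : ∃ x, f x ≠ ⊤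

/-- The Fenchel–Legendre transform `f^*`. -/
noncomputable def fenchelLegendre (f : ℝ → EReal) (s : ℝ) : EReal :=
  ⨆ α : ℝ, (((α * s : ℝ) : EReal) - f α)

/-- A rate function is lower semicontinuous with values in `[0, ∞]`. -/
structure IsRateFunction (I : ℝ → EReal) : Prop where
  nonneg : ∀ s, 0 ≤ I s
  lowerSemicontinuous : LowerSemicontinuous I

/-- A good rate function has, in addition, compact level sets. -/
structure IsGoodRateFunction (I : ℝ → EReal) : Prop extends IsRateFunction I where
  isCompact_level : ∀ a : ℝ, IsCompact {s | I s ≤ (a : EReal)}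

/-- The full large deviation principle at speed `t` with rate function `I` for the real random
variables `Z t`. Logarithms take values in `[-∞, ∞]`, with `log 0 = -∞`. -/
structure SatisfiesLDP {Ω : Type*} [MeasurableSpace Ω] (P : Measure Ω) (Z : ℕ → Ω → ℝ)
    (I : ℝ → EReal) : Prop where
  isRateFunction : IsRateFunction I
  lower_bound : ∀ O : Set ℝ, IsOpen O →
    -(⨅ s ∈ O, I s) ≤ liminf (fun t : ℕ => ENNReal.log (P {ω | Z t ω ∈ O}) / (t : EReal)) atTop
  upper_bound : ∀ Γ : Set ℝ, IsClosed Γ →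
    limsup (fun t : ℕ => ENNReal.log (P {ω | Z t ω ∈ Γ}) / (t : EReal)) atTop ≤ -(⨅ s ∈ Γ, I s)

end SymbolicLDP

open SymbolicLDP

/-!
The words of length `t` with their `P`-probabilities carry the observable `log (P(w) / P'(w))`,
which is `σ_t`. Decoupling provides, for words `u` of length `t` and `v`, a word `u ξ v` on which
both probabilities, hence also `e^{α σ}` for every `α`, factor up to `e^{o(t)}`. The length of `ξ`
varies, and the entropy production is not controlled when a word is cut or extended arbitrarily.
But a single letter can always be put in front of a word at the cost of a constant factor for both
measures (`exists_cons`): the probability of a word decreases under extension to the left, and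
decoupling from a fixed letter bounds the loss. So the gap can be padded to the length `τ t` exactly
(`exists_exact_decoupling`), and gluing is at most `(τ t + 1)`-to-one. This is the structure
`IsGluingFamily`; everything else follows from it.

Gluing makes `log E[e^{α σ_t}]` superadditive with gaps and errors `o(t)`, so that Fekete's argument
gives the limit `q` as a supremum of continuous functions of `α`, with values in `(-∞, ∞]`
(`tendsto_pressure`).

For the lower bound, call `(s, y)` achievable if `σ_T / T` is near `s` with probability at least
`e^{-T y}`, up to subexponential factors. By gluing, it is enough to have this along a sequence of
lengths (`mem_achievable_of_frequently`), and the achievable set is closed and convex. Long words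
glued from blocks of one fixed length have `|σ_T| ≤ M T` and already account for any exponential
rate below `q(α)`; hence, by compactness of `[-M, M]`, each `l < q(α)` comes with an achievable
point `(s, α s - l)` (`exists_mem_achievable`). A separation argument then shows that the achievable
set contains the epigraph of `q^*`; no differentiability or finiteness of `q` is needed.

The upper bound for arbitrary closed sets uses Chebyshev's inequality on two half-lines only. Since
`inf q^* = 0`, a closed set on which `q^* > z > 0` misses a nonempty sublevel interval of `q^*`, and
is covered by one half-line on each side of it (`limsup_le`). In particular no exponential tightness
is used.
-/

namespace SymbolicLDP

/-! ### Gluing families -/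

section Abstract

variable {W : ℕ → Type*} [∀ t, Fintype (W t)]

/-- The exponential moment `E[e^{α f_t}; f_t ∈ S]` of the observable `f t` with respect to the
weights `p t` on the finite set `W t`. For `α = 0` this is the probability of `f_t ∈ S`. -/
noncomputable def tiltedMass (p f : ∀ t, W t → ℝ) (t : ℕ) (α : ℝ) (S : Set ℝ) : ℝ :=
  ∑ w, p t w * S.indicator (fun x => Real.exp (α * x)) (f t w)

/-- A sequence of observables `f t` on finite probability spaces `(W t, p t)` which is additive
under gluing, up to sublinear errors: `u : W t` and `v : W s` are glued to an element of
`W (t + τ t + s)`, at most `τ t + 1` pairs giving the same result. The index in `Fin (τ t + 1)`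
tells those pairs apart. -/
structure IsGluingFamily (p f : ∀ t, W t → ℝ) (τ : ℕ → ℕ) (e : ℕ → ℝ) : Prop where
  nonneg : ∀ t w, 0 ≤ p t w
  sum_eq_one : ∀ t, ∑ w, p t w = 1
  error_nonneg : ∀ t, 0 ≤ e t
  tendsto_error : Tendsto (fun t : ℕ => e t / t) atTop (𝓝 0)
  tendsto_gap : Tendsto (fun t : ℕ => (τ t : ℝ) / t) atTop (𝓝 0)
  glue : ∀ t s, 1 ≤ t → 1 ≤ s → ∃ Φ : W t × W s → W (t + τ t + s) × Fin (τ t + 1),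
    Function.Injective Φ ∧ ∀ u v, 0 < p t u → 0 < p s v →
      Real.exp (-e t) * (p t u * p s v) ≤ p _ (Φ (u, v)).1 ∧
      |f _ (Φ (u, v)).1 - f t u - f s v| ≤ 2 * e t

/-- The defect of superadditivity of the logarithmic exponential moments. -/
noncomputable def gluingDefect (τ : ℕ → ℕ) (e : ℕ → ℝ) (α : ℝ) (t : ℕ) : ℝ :=
  (1 + 2 * |α|) * e t + Real.log (τ t + 1)

namespace IsGluingFamily

variable {p f : ∀ t, W t → ℝ} {τ : ℕ → ℕ} {e : ℕ → ℝ}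

/-! ### Exponential moments of a gluing family -/

lemma indicator_exp_nonneg (α : ℝ) (S : Set ℝ) (x : ℝ) :
    0 ≤ S.indicator (fun x => Real.exp (α * x)) x :=
  Set.indicator_nonneg (fun _ _ => (Real.exp_pos _).le) _

lemma tiltedMass_nonneg (h : IsGluingFamily p f τ e) (t : ℕ) (α : ℝ) (S : Set ℝ) :
    0 ≤ tiltedMass p f t α S :=
  Finset.sum_nonneg fun w _ => mul_nonneg (h.nonneg t w) (indicator_exp_nonneg α S _)

lemma tiltedMass_mono (h : IsGluingFamily p f τ e) (t : ℕ) (α : ℝ) {S T : Set ℝ} (hST : S ⊆ T) :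
    tiltedMass p f t α S ≤ tiltedMass p f t α T :=
  Finset.sum_le_sum fun w _ => mul_le_mul_of_nonneg_left
    (Set.indicator_le_indicator_of_subset hST (fun _ => (Real.exp_pos _).le) _) (h.nonneg t w)

lemma tiltedMass_union_le (h : IsGluingFamily p f τ e) (t : ℕ) (α : ℝ) (S T : Set ℝ) :
    tiltedMass p f t α (S ∪ T) ≤ tiltedMass p f t α S + tiltedMass p f t α T := by
  unfold tiltedMass
  rw [← Finset.sum_add_distrib]
  refine Finset.sum_le_sum fun w _ => ?_
  rw [← mul_add]
  refine mul_le_mul_of_nonneg_left ?_ (h.nonneg t w)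
  have h1 := indicator_exp_nonneg α S (f t w)
  have h2 := indicator_exp_nonneg α T (f t w)
  by_cases hS : f t w ∈ S
  · rw [Set.indicator_of_mem (Set.mem_union_left T hS), Set.indicator_of_mem hS]; linarith
  by_cases hT : f t w ∈ T
  · rw [Set.indicator_of_mem (Set.mem_union_right S hT), Set.indicator_of_mem hT]; linarith
  · rw [Set.indicator_of_notMem (by simp [hS, hT])]; linarith

lemma tiltedMass_zero_univ (h : IsGluingFamily p f τ e) (t : ℕ) :
    tiltedMass p f t 0 Set.univ = 1 := by
  simpa [tiltedMass] using h.sum_eq_one t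

lemma tiltedMass_zero_le_one (h : IsGluingFamily p f τ e) (t : ℕ) (S : Set ℝ) :
    tiltedMass p f t 0 S ≤ 1 :=
  (h.tiltedMass_mono t 0 (Set.subset_univ S)).trans_eq (h.tiltedMass_zero_univ t)

lemma tiltedMass_univ_pos (h : IsGluingFamily p f τ e) (t : ℕ) (α : ℝ) :
    0 < tiltedMass p f t α Set.univ := by
  obtain ⟨w, -, hw⟩ : ∃ w ∈ Finset.univ, 0 < p t w := by
    by_contra! hcon
    have := Finset.sum_nonpos hcon
    rw [h.sum_eq_one t] at this
    linarith
  refine Finset.sum_pos' (fun w _ => mul_nonneg (h.nonneg t w) (indicator_exp_nonneg _ _ _))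
    ⟨w, Finset.mem_univ w, mul_pos hw ?_⟩
  simpa using Real.exp_pos _

/-- Change of the tilt on a set where `α x ≤ β x + c`. -/
lemma tiltedMass_le_exp_mul (h : IsGluingFamily p f τ e) (t : ℕ) {α β c : ℝ} {S : Set ℝ}
    (hS : ∀ x ∈ S, α * x ≤ β * x + c) :
    tiltedMass p f t α S ≤ Real.exp c * tiltedMass p f t β S := by
  unfold tiltedMass
  rw [Finset.mul_sum]
  refine Finset.sum_le_sum fun w _ => ?_
  rw [mul_left_comm]
  refine mul_le_mul_of_nonneg_left ?_ (h.nonneg t w)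
  by_cases hw : f t w ∈ S
  · rw [Set.indicator_of_mem hw, Set.indicator_of_mem hw, ← Real.exp_add]
    exact Real.exp_le_exp.2 (by linarith [hS _ hw])
  · simp [Set.indicator_of_notMem hw]

/-- On a finite space the observable is bounded, so that a bounded interval carries all the mass. -/
lemma exists_bound (f : ∀ t, W t → ℝ) (t : ℕ) : ∃ B, 0 ≤ B ∧ ∀ w, |f t w| ≤ B :=
  ⟨∑ w, |f t w|, Finset.sum_nonneg fun _ _ => abs_nonneg _, fun w =>
    Finset.single_le_sum (f := fun w => |f t w|) (fun _ _ => abs_nonneg _) (Finset.mem_univ w)⟩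

lemma tiltedMass_eq_univ {t : ℕ} {α : ℝ} {S : Set ℝ} (hS : ∀ w, f t w ∈ S) :
    tiltedMass p f t α S = tiltedMass p f t α Set.univ := by
  simp [tiltedMass, Set.indicator_of_mem (hS _)]

/-- Supermultiplicativity of the exponential moments under gluing. -/
lemma tiltedMass_glue (h : IsGluingFamily p f τ e) {t s : ℕ} (ht : 1 ≤ t) (hs : 1 ≤ s) (α : ℝ)
    {S S' U : Set ℝ} (hU : ∀ x ∈ S, ∀ y ∈ S', ∀ z, |z - x - y| ≤ 2 * e t → z ∈ U) :
    Real.exp (-gluingDefect τ e α t) * (tiltedMass p f t α S * tiltedMass p f s α S') ≤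
      tiltedMass p f (t + τ t + s) α U := by
  classical
  obtain ⟨Φ, hinj, hΦ⟩ := h.glue t s ht hs
  set κ := (1 + 2 * |α|) * e t with hκ
  set g : Set ℝ → ℝ → ℝ := fun S => S.indicator (fun x => Real.exp (α * x)) with hg
  have hτ : (0 : ℝ) < τ t + 1 := by positivity
  have key : Real.exp (-κ) * (tiltedMass p f t α S * tiltedMass p f s α S') ≤
      (τ t + 1) * tiltedMass p f (t + τ t + s) α U := by
    calc Real.exp (-κ) * (tiltedMass p f t α S * tiltedMass p f s α S')
        = ∑ x : W t × W s, Real.exp (-κ) *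
            ((p t x.1 * g S (f t x.1)) * (p s x.2 * g S' (f s x.2))) := by
          rw [tiltedMass, tiltedMass, Finset.sum_mul_sum, ← Finset.mul_sum, Fintype.sum_prod_type]
      _ ≤ ∑ x : W t × W s, p _ (Φ x).1 * g U (f _ (Φ x).1) := by
          refine Finset.sum_le_sum fun x _ => ?_
          obtain ⟨u, v⟩ := x
          have hR : 0 ≤ p _ (Φ (u, v)).1 * g U (f _ (Φ (u, v)).1) :=
            mul_nonneg (h.nonneg _ _) (indicator_exp_nonneg _ _ _)
          by_cases hu : f t u ∈ S
          swap
          · simpa [hg, Set.indicator_of_notMem hu] using hR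
          by_cases hv : f s v ∈ S'
          swap
          · simpa [hg, Set.indicator_of_notMem hv] using hR
          rcases (h.nonneg t u).eq_or_lt with hpu | hpu
          · simpa [← hpu] using hR
          rcases (h.nonneg s v).eq_or_lt with hpv | hpv
          · simpa [← hpv] using hR
          obtain ⟨h1, h2⟩ := hΦ u v hpu hpv
          have hmem := hU _ hu _ hv _ h2
          simp only [hg, Set.indicator_of_mem hu, Set.indicator_of_mem hv,
            Set.indicator_of_mem hmem]
          have h3 : α * (f t u + f s v) - 2 * |α| * e t ≤ α * f _ (Φ (u, v)).1 := by
            have h4 : |α * (f _ (Φ (u, v)).1 - f t u - f s v)| ≤ |α| * (2 * e t) := by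
              rw [abs_mul]; exact mul_le_mul_of_nonneg_left h2 (abs_nonneg _)
            nlinarith [neg_abs_le (α * (f _ (Φ (u, v)).1 - f t u - f s v))]
          calc Real.exp (-κ) * ((p t u * Real.exp (α * f t u)) * (p s v * Real.exp (α * f s v)))
              = (Real.exp (-e t) * (p t u * p s v)) *
                  Real.exp (α * (f t u + f s v) - 2 * |α| * e t) := by
                have : Real.exp (-κ) * (Real.exp (α * f t u) * Real.exp (α * f s v)) =
                    Real.exp (-e t) * Real.exp (α * (f t u + f s v) - 2 * |α| * e t) := by
                  rw [← Real.exp_add, ← Real.exp_add, ← Real.exp_add, hκ]; congr 1; ring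
                linear_combination (p t u * p s v) * this
            _ ≤ _ := mul_le_mul h1 (Real.exp_le_exp.2 h3) (Real.exp_pos _).le (h.nonneg _ _)
      _ ≤ ∑ y : W (t + τ t + s) × Fin (τ t + 1), p _ y.1 * g U (f _ y.1) := by
          rw [← Finset.sum_image (s := Finset.univ) (g := Φ)
            (f := fun y => p _ y.1 * g U (f _ y.1)) (fun x _ y _ hxy => hinj hxy)]
          exact Finset.sum_le_sum_of_subset_of_nonneg (Finset.subset_univ _)
            fun y _ _ => mul_nonneg (h.nonneg _ _) (indicator_exp_nonneg _ _ _)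
      _ = (τ t + 1) * tiltedMass p f (t + τ t + s) α U := by
          rw [Fintype.sum_prod_type]
          simp [tiltedMass, hg, Finset.mul_sum]
  -- The multiplicity `τ t + 1` of the gluing map is the logarithmic term of the defect.
  have hsplit : Real.exp (-gluingDefect τ e α t) = Real.exp (-κ) / (τ t + 1) := by
    rw [gluingDefect, neg_add, Real.exp_add, Real.exp_neg (Real.log _), Real.exp_log hτ,
      div_eq_mul_inv]
  rw [hsplit, div_mul_eq_mul_div, div_le_iff₀ hτ]
  linarith

/-- Gluing `n` blocks of length `t` to a block of length `r`. -/
lemma tiltedMass_glue_iterate (h : IsGluingFamily p f τ e) {t r : ℕ} (ht : 1 ≤ t) (hr : 1 ≤ r)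
    (α a b a' b' : ℝ) (n : ℕ) :
    (Real.exp (-gluingDefect τ e α t) * tiltedMass p f t α (Set.Icc a b)) ^ n *
        tiltedMass p f r α (Set.Icc a' b') ≤
      tiltedMass p f (n * (t + τ t) + r) α
        (Set.Icc (n * (a - 2 * e t) + a') (n * (b + 2 * e t) + b')) := by
  induction n with
  | zero => simp
  | succ n ih =>
    have hlen : (n + 1) * (t + τ t) + r = t + τ t + (n * (t + τ t) + r) := by ring
    rw [hlen, pow_succ', mul_assoc]
    refine le_trans ?_ (h.tiltedMass_glue ht (by omega) α
      (S := Set.Icc a b) (S' := Set.Icc (n * (a - 2 * e t) + a') (n * (b + 2 * e t) + b')) ?_)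
    · rw [mul_assoc]
      gcongr
      exact h.tiltedMass_nonneg _ _ _
    · rintro x ⟨hx1, hx2⟩ y ⟨hy1, hy2⟩ z hz
      obtain ⟨hz1, hz2⟩ := abs_le.1 hz
      push_cast
      constructor <;> linarith

/-- The exponential growth that a single length `t` provides, for all lengths `T`: the number of
blocks of length `t` is the largest which leaves room for a nonempty remainder. -/
lemma exists_growth (h : IsGluingFamily p f τ e) {t : ℕ} (ht : 1 ≤ t) (α a b : ℝ)
    (hpos : 0 < tiltedMass p f t α (Set.Icc a b)) :
    ∃ C, 0 ≤ C ∧ ∀ T : ℕ, 1 ≤ T → ∃ n : ℕ, (n * (t + τ t) : ℝ) ≤ T ∧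
      (T : ℝ) ≤ n * (t + τ t) + (t + τ t) ∧
      Real.exp (T * ((Real.log (tiltedMass p f t α (Set.Icc a b)) - gluingDefect τ e α t) /
        (t + τ t)) - C) ≤
      tiltedMass p f T α (Set.Icc (n * (a - 2 * e t) - C) (n * (b + 2 * e t) + C)) := by
  choose B hB0 hB using exists_bound f
  set m := t + τ t with hm
  have hm0 : 0 < m := by omega
  set y := Real.log (tiltedMass p f t α (Set.Icc a b)) - gluingDefect τ e α t with hy
  set Z : ℕ → ℝ := fun r => tiltedMass p f r α Set.univ with hZ
  set K : ℕ → ℝ := fun r => B r + |Real.log (Z r)| with hK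
  have hK0 : ∀ r, 0 ≤ K r := fun r => add_nonneg (hB0 r) (abs_nonneg _)
  refine ⟨(∑ r ∈ Finset.range (m + 1), K r) + |y|,
    add_nonneg (Finset.sum_nonneg fun r _ => hK0 r) (abs_nonneg _), fun T hT => ?_⟩
  set C := (∑ r ∈ Finset.range (m + 1), K r) + |y| with hC
  have hdiv := Nat.div_add_mod (T - 1) m
  have hmod := Nat.mod_lt (T - 1) hm0
  set n := (T - 1) / m
  set r := (T - 1) % m + 1 with hr
  have hTn : T = n * m + r := by rw [mul_comm n m]; omega
  have hrm : r ≤ m := by omega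
  have hKr : K r ≤ ∑ r ∈ Finset.range (m + 1), K r :=
    Finset.single_le_sum (f := K) (fun r _ => hK0 r) (Finset.mem_range.2 (by omega))
  have hmR : (m : ℝ) = t + τ t := by push_cast [hm]; ring
  have hmR0 : (0 : ℝ) < m := by exact_mod_cast hm0
  have hTR : (T : ℝ) = n * m + r := by rw [hTn]; push_cast; ring
  have hrR : (r : ℝ) ≤ m := by exact_mod_cast hrm
  have hrR0 : (0 : ℝ) ≤ r := by positivity
  refine ⟨n, by rw [← hmR]; linarith, by rw [← hmR]; linarith, ?_⟩
  have hmain := h.tiltedMass_glue_iterate ht (r := r) (by omega) α a b (-B r) (B r) n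
  rw [← hm, ← hTn, tiltedMass_eq_univ (fun w => abs_le.1 (hB r w))] at hmain
  have hB1 : B r ≤ C := by
    have : 0 ≤ |Real.log (Z r)| := abs_nonneg _
    have : 0 ≤ |y| := abs_nonneg _
    simp only [hK] at hKr
    linarith
  refine le_trans ?_ (hmain.trans (h.tiltedMass_mono T α (Set.Icc_subset_Icc ?_ ?_)))
  · have hZr : 0 < Z r := h.tiltedMass_univ_pos r α
    rw [← Real.exp_log hpos, ← Real.exp_add, ← Real.exp_nat_mul]
    change _ ≤ _ * Z r
    rw [← Real.exp_log hZr, ← Real.exp_add, ← hmR]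
    refine Real.exp_le_exp.2 ?_
    have h1 : (T : ℝ) * (y / m) = n * y + r / m * y := by
      rw [hTR]; field_simp
    have h2 : r / m * y ≤ |y| := by
      have : (r : ℝ) / m ≤ 1 := (div_le_one hmR0).2 hrR
      have : (r : ℝ) / m * y ≤ r / m * |y| := by gcongr; exact le_abs_self y
      nlinarith [abs_nonneg y]
    have h3 := neg_abs_le (Real.log (Z r))
    have h4 := hB0 r
    simp only [hK] at hKr
    rw [h1]
    have : (n : ℝ) * (-gluingDefect τ e α t + Real.log (tiltedMass p f t α (Set.Icc a b))) =
      n * y := by rw [hy]; ring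
    rw [this]
    linarith
  · linarith
  · linarith

end IsGluingFamily

/-! ### The pressure -/

/-- The pressure of a gluing family, written as the supremum that Fekete's lemma gives for the
limit of `(1 / t) log E[e^{α f_t}]`. Only the lengths `t + 1 ≥ 1` enter. -/
noncomputable def pressure (p f : ∀ t, W t → ℝ) (τ : ℕ → ℕ) (e : ℕ → ℝ) (α : ℝ) : EReal :=
  ⨆ t : ℕ, (((Real.log (tiltedMass p f (t + 1) α Set.univ) - gluingDefect τ e α (t + 1)) /
    (((t + 1 : ℕ) : ℝ) + τ (t + 1)) : ℝ) : EReal)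

/-- The set of the pairs `(s, y)` such that `f_T / T` is near `s` with probability at least
`e^{-T y}`, up to subexponential factors, for all large `T`. It is the epigraph of the
Ruelle-Lanford rate function. -/
def achievable (p f : ∀ t, W t → ℝ) : Set (ℝ × ℝ) :=
  {x | ∀ ε > 0, ∀ᶠ T : ℕ in atTop, Real.exp (-(T * (x.2 + ε))) ≤
    tiltedMass p f T 0 (Set.Icc (T * (x.1 - ε)) (T * (x.1 + ε)))}

namespace IsGluingFamily

variable {p f : ∀ t, W t → ℝ} {τ : ℕ → ℕ} {e : ℕ → ℝ}

lemma gluingDefect_nonneg (h : IsGluingFamily p f τ e) (α : ℝ) (t : ℕ) :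
    0 ≤ gluingDefect τ e α t := by
  have := h.error_nonneg t
  have : 0 ≤ Real.log (τ t + 1) := Real.log_nonneg (by linarith [(τ t).cast_nonneg (α := ℝ)])
  unfold gluingDefect
  positivity

lemma tendsto_gluingDefect (h : IsGluingFamily p f τ e) (α : ℝ) :
    Tendsto (fun t : ℕ => gluingDefect τ e α t / t) atTop (𝓝 0) := by
  have h1 : Tendsto (fun t : ℕ => (1 + 2 * |α|) * (e t / t) + (τ t : ℝ) / t) atTop (𝓝 0) := by
    simpa using (h.tendsto_error.const_mul (1 + 2 * |α|)).add h.tendsto_gap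
  refine squeeze_zero (fun t => div_nonneg (h.gluingDefect_nonneg α t) t.cast_nonneg)
    (fun t => ?_) h1
  have : Real.log (τ t + 1) ≤ τ t := by
    linarith [Real.log_le_sub_one_of_pos (show (0 : ℝ) < τ t + 1 by positivity)]
  calc gluingDefect τ e α t / t ≤ ((1 + 2 * |α|) * e t + τ t) / t := by
        unfold gluingDefect; gcongr
    _ = _ := by ring

lemma eventually_le_mul {u : ℕ → ℝ} (hu : Tendsto (fun t : ℕ => u t / t) atTop (𝓝 0)) {ε : ℝ}
    (hε : 0 < ε) : ∀ᶠ t : ℕ in atTop, u t ≤ ε * t := by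
  filter_upwards [hu.eventually (gt_mem_nhds hε), eventually_ge_atTop 1] with t ht h1
  have : (0 : ℝ) < t := by exact_mod_cast h1
  exact ((div_lt_iff₀ this).1 ht).le

lemma eventually_const_le_mul (C : ℝ) {ε : ℝ} (hε : 0 < ε) :
    ∀ᶠ t : ℕ in atTop, C ≤ t * ε :=
  (tendsto_natCast_atTop_atTop.atTop_mul_const hε).eventually_ge_atTop C

lemma coe_le_pressure {t : ℕ} (ht : 1 ≤ t) (α : ℝ) :
    (((Real.log (tiltedMass p f t α Set.univ) - gluingDefect τ e α t) / (t + τ t) : ℝ) : EReal) ≤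
      pressure p f τ e α := by
  obtain ⟨t, rfl⟩ : ∃ k, t = k + 1 := ⟨t - 1, by omega⟩
  exact le_iSup (fun t : ℕ => (((Real.log (tiltedMass p f (t + 1) α Set.univ) -
    gluingDefect τ e α (t + 1)) / (((t + 1 : ℕ) : ℝ) + τ (t + 1)) : ℝ) : EReal)) t

lemma pressure_ne_bot (α : ℝ) : pressure p f τ e α ≠ ⊥ :=
  ne_bot_of_le_ne_bot (EReal.coe_ne_bot _) (coe_le_pressure le_rfl α)

/-- Below the pressure, already the values `|f_T| ≤ M T` contribute to the exponential moments: long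
words glued from blocks of one fixed length have values of linear size. -/
lemma exists_truncation (h : IsGluingFamily p f τ e) {α l : ℝ}
    (hl : (l : EReal) < pressure p f τ e α) :
    ∃ M, ∀ᶠ T : ℕ in atTop,
      Real.exp (T * l) ≤ tiltedMass p f T α (Set.Icc (T * (-M)) (T * M)) := by
  obtain ⟨t', ht'⟩ := lt_iSup_iff.1 hl
  obtain ⟨t, ht, rfl⟩ : ∃ t, 1 ≤ t ∧ t = t' + 1 := ⟨t' + 1, by omega, rfl⟩
  rw [EReal.coe_lt_coe_iff] at ht'
  set t := t' + 1
  obtain ⟨B, hB0, hB⟩ := exists_bound f t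
  have huniv : tiltedMass p f t α (Set.Icc (-B) B) = tiltedMass p f t α Set.univ :=
    tiltedMass_eq_univ fun w => abs_le.1 (hB w)
  obtain ⟨C, hC0, hC⟩ := h.exists_growth ht α (-B) B (huniv ▸ h.tiltedMass_univ_pos t α)
  rw [huniv] at hC
  set l' := (Real.log (tiltedMass p f t α Set.univ) - gluingDefect τ e α t) / (t + τ t)
  refine ⟨B + 2 * e t + C, ?_⟩
  filter_upwards [eventually_const_le_mul C (sub_pos.2 ht'), eventually_ge_atTop 1] with T hT hT1
  obtain ⟨n, hn1, -, hn⟩ := hC T hT1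
  have hT1' : (1 : ℝ) ≤ T := by exact_mod_cast hT1
  have ht1 : (1 : ℝ) ≤ t + τ t := by
    have : (1 : ℝ) ≤ t := by exact_mod_cast ht
    linarith [(τ t).cast_nonneg (α := ℝ)]
  have hnT : (n : ℝ) ≤ T := by nlinarith [n.cast_nonneg (α := ℝ)]
  have he := h.error_nonneg t
  have h2 : (n : ℝ) * (B + 2 * e t) ≤ T * (B + 2 * e t) := by gcongr
  have h3 : C ≤ T * C := by nlinarith
  refine le_trans (Real.exp_le_exp.2 ?_) (hn.trans (h.tiltedMass_mono T α
    (Set.Icc_subset_Icc ?_ ?_)))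
  · linarith
  · linarith
  · linarith

/-- Fekete's lemma for the logarithmic exponential moments. -/
lemma tendsto_pressure (h : IsGluingFamily p f τ e) (α : ℝ) :
    Tendsto (fun T : ℕ => ((Real.log (tiltedMass p f T α Set.univ) / T : ℝ) : EReal)) atTop
      (𝓝 (pressure p f τ e α)) := by
  refine tendsto_order.2 ⟨fun a ha => ?_, fun b hb => ?_⟩
  · obtain ⟨l, hal, hl⟩ := EReal.lt_iff_exists_real_btwn.1 ha
    obtain ⟨M, hM⟩ := h.exists_truncation hl
    filter_upwards [hM, eventually_ge_atTop 1] with T hT hT1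
    have hT0 : (0 : ℝ) < T := by exact_mod_cast hT1
    refine hal.trans_le (EReal.coe_le_coe_iff.2 ?_)
    rw [le_div_iff₀ hT0, mul_comm, Real.le_log_iff_exp_le (h.tiltedMass_univ_pos T α)]
    exact hT.trans (h.tiltedMass_mono T α (Set.subset_univ _))
  · have hS : pressure p f τ e α = ((pressure p f τ e α).toReal : EReal) :=
      (EReal.coe_toReal (ne_top_of_lt hb) (pressure_ne_bot α)).symm
    set S := (pressure p f τ e α).toReal
    have hlim : Tendsto (fun T : ℕ => S * (1 + (τ T : ℝ) / T) + gluingDefect τ e α T / T) atTop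
        (𝓝 S) := by
      simpa using ((h.tendsto_gap.const_add 1).const_mul S).add (h.tendsto_gluingDefect α)
    have hlim' := (continuous_coe_real_ereal.tendsto S).comp hlim
    rw [hS] at hb
    filter_upwards [hlim'.eventually (gt_mem_nhds hb), eventually_ge_atTop 1] with T hT hT1
    refine lt_of_le_of_lt (EReal.coe_le_coe_iff.2 ?_) hT
    have hT0 : (0 : ℝ) < T := by exact_mod_cast hT1
    have hle := coe_le_pressure (p := p) (f := f) (τ := τ) (e := e) hT1 α
    rw [hS, EReal.coe_le_coe_iff, div_le_iff₀ (by positivity)] at hle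
    rw [div_le_iff₀ hT0]
    field_simp
    linarith

lemma lowerSemicontinuous_pressure (h : IsGluingFamily p f τ e) :
    LowerSemicontinuous (pressure p f τ e) := by
  refine lowerSemicontinuous_iSup fun t => Continuous.lowerSemicontinuous ?_
  refine continuous_coe_real_ereal.comp (Continuous.div_const (Continuous.sub ?_ ?_) _)
  · refine Continuous.log ?_ fun α => (h.tiltedMass_univ_pos _ α).ne'
    simp only [tiltedMass, Set.indicator_univ]
    fun_prop
  · unfold gluingDefect
    fun_prop

lemma pressure_zero (h : IsGluingFamily p f τ e) : pressure p f τ e 0 = 0 := by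
  refine tendsto_nhds_unique (h.tendsto_pressure 0) ?_
  simp [h.tiltedMass_zero_univ]

lemma log_tiltedMass_convex (h : IsGluingFamily p f τ e) (t : ℕ) {a b : ℝ} (ha : 0 ≤ a)
    (hb : 0 ≤ b) (hab : a + b = 1) (α β : ℝ) :
    Real.log (tiltedMass p f t (a * α + b * β) Set.univ) ≤
      a * Real.log (tiltedMass p f t α Set.univ) + b * Real.log (tiltedMass p f t β Set.univ) := by
  set x := Real.log (tiltedMass p f t α Set.univ) with hx
  set y := Real.log (tiltedMass p f t β Set.univ) with hy
  have hα := h.tiltedMass_univ_pos t α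
  have hβ := h.tiltedMass_univ_pos t β
  have key : Real.exp (-(a * x + b * y)) * tiltedMass p f t (a * α + b * β) Set.univ ≤ 1 := by
    calc Real.exp (-(a * x + b * y)) * tiltedMass p f t (a * α + b * β) Set.univ
        = ∑ w, p t w * Real.exp (a * (α * f t w - x) + b * (β * f t w - y)) := by
          simp only [tiltedMass, Set.indicator_univ, Finset.mul_sum]
          refine Finset.sum_congr rfl fun w _ => ?_
          rw [mul_left_comm, ← Real.exp_add]
          congr 2; ring
      _ ≤ ∑ w, p t w * (a * Real.exp (α * f t w - x) + b * Real.exp (β * f t w - y)) := by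
          refine Finset.sum_le_sum fun w _ => mul_le_mul_of_nonneg_left ?_ (h.nonneg t w)
          simpa using convexOn_exp.2 (Set.mem_univ (α * f t w - x)) (Set.mem_univ (β * f t w - y))
            ha hb hab
      _ = a * (Real.exp (-x) * tiltedMass p f t α Set.univ) +
            b * (Real.exp (-y) * tiltedMass p f t β Set.univ) := by
          simp only [tiltedMass, Set.indicator_univ, Finset.mul_sum, ← Finset.sum_add_distrib]
          refine Finset.sum_congr rfl fun w _ => ?_
          rw [sub_eq_add_neg, sub_eq_add_neg, Real.exp_add, Real.exp_add]
          ring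
      _ = 1 := by
          rw [Real.exp_neg, Real.exp_neg, hx, hy, Real.exp_log hα, Real.exp_log hβ,
            inv_mul_cancel₀ hα.ne', inv_mul_cancel₀ hβ.ne']
          linarith
  rw [Real.log_le_iff_le_exp (h.tiltedMass_univ_pos t _)]
  rw [Real.exp_neg, inv_mul_le_iff₀ (Real.exp_pos _)] at key
  simpa using key

lemma isConvexFun_pressure (h : IsGluingFamily p f τ e) : IsConvexFun (pressure p f τ e) := by
  rintro ⟨α, x⟩ hx ⟨β, y⟩ hy a b ha hb hab
  simp only [Set.mem_ofPred_eq, Prod.fst_add, Prod.snd_add, Prod.smul_fst, Prod.smul_snd,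
    smul_eq_mul] at hx hy ⊢
  refine EReal.le_of_forall_lt_iff_le.1 fun z hz => ?_
  rw [EReal.coe_lt_coe_iff] at hz
  set ε := z - (a * x + b * y) with hε
  have hε0 : 0 < ε := sub_pos.2 hz
  refine le_of_tendsto (h.tendsto_pressure _) ?_
  have hlt : ∀ c : ℝ, (c : EReal) < ((c + ε : ℝ) : EReal) := fun c =>
    EReal.coe_lt_coe_iff.2 (by linarith)
  filter_upwards [(h.tendsto_pressure α).eventually (gt_mem_nhds (hx.trans_lt (hlt x))),
    (h.tendsto_pressure β).eventually (gt_mem_nhds (hy.trans_lt (hlt y)))] with T h1 h2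
  rw [EReal.coe_lt_coe_iff] at h1 h2
  rw [EReal.coe_le_coe_iff]
  have h3 := div_le_div_of_nonneg_right (h.log_tiltedMass_convex T ha hb hab α β)
    (T.cast_nonneg (α := ℝ))
  have h4 := mul_le_mul_of_nonneg_left h1.le ha
  have h5 := mul_le_mul_of_nonneg_left h2.le hb
  have h6 : a * (x + ε) + b * (y + ε) = z := by
    have : b = 1 - a := by linarith
    subst this; rw [hε]; ring
  calc _ ≤ _ := h3
    _ = a * (Real.log (tiltedMass p f T α Set.univ) / T) +
        b * (Real.log (tiltedMass p f T β Set.univ) / T) := by ring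
    _ ≤ z := by linarith

/-! ### Achievable rates -/

/-- A rate which is achieved along arbitrarily large lengths is achieved along all large lengths:
glue blocks of one suitable length. -/
lemma mem_achievable_of_frequently (h : IsGluingFamily p f τ e) {s y : ℝ}
    (hfr : ∀ ε > 0, ∃ᶠ T : ℕ in atTop, Real.exp (-(T * (y + ε))) ≤
      tiltedMass p f T 0 (Set.Icc (T * (s - ε)) (T * (s + ε)))) :
    (s, y) ∈ achievable p f := by
  intro ε hε
  have hsum : Tendsto (fun t : ℕ => (|s| * τ t + 2 * e t) / t) atTop (𝓝 0) := by
    have := (h.tendsto_gap.const_mul |s|).add (h.tendsto_error.const_mul 2)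
    simp only [mul_zero, add_zero] at this
    exact this.congr fun t => by ring
  obtain ⟨t, htp, hte, htd, ht⟩ := ((hfr (ε / 4) (by positivity)).and_eventually
    ((eventually_le_mul hsum (show 0 < ε / 4 by positivity)).and
      ((eventually_le_mul (h.tendsto_gluingDefect 0) (show 0 < ε / 4 by positivity)).and
        (eventually_ge_atTop 1)))).exists
  have ht0 : (0 : ℝ) < t := by exact_mod_cast ht
  set P := tiltedMass p f t 0 (Set.Icc (t * (s - ε / 4)) (t * (s + ε / 4))) with hP
  have hP0 : 0 < P := (Real.exp_pos _).trans_le htp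
  have hy0 : 0 ≤ t * (y + ε / 4) := by
    have := htp.trans (h.tiltedMass_zero_le_one t _)
    rw [Real.exp_le_one_iff] at this
    linarith
  have hlog : -(t * (y + ε / 4)) ≤ Real.log P := (Real.le_log_iff_exp_le hP0).2 htp
  obtain ⟨C, hC0, hC⟩ := h.exists_growth ht 0 _ _ hP0
  rw [← hP] at hC
  have hτ0 : (0 : ℝ) ≤ τ t := Nat.cast_nonneg _
  have hl : -(y + ε / 2) ≤ (Real.log P - gluingDefect τ e 0 t) / (t + τ t) := by
    rw [le_div_iff₀ (by positivity)]
    have : 0 ≤ (y + ε / 2) * τ t := by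
      refine mul_nonneg ?_ hτ0
      have := nonneg_of_mul_nonneg_right hy0 ht0
      linarith
    nlinarith
  filter_upwards [eventually_const_le_mul (|s| * (t + τ t) + C) (half_pos hε),
    eventually_ge_atTop 1] with T hT hT1
  obtain ⟨n, hn1, hn2, hn⟩ := hC T hT1
  have hn0 : (0 : ℝ) ≤ n := n.cast_nonneg
  have hs0 : 0 ≤ |s| * (t + τ t) := by positivity
  have hnτ : (0 : ℝ) ≤ n * τ t := by positivity
  have hnt : (n : ℝ) * t ≤ T := by nlinarith
  have hdist : |n * t * s - T * s| ≤ |s| * (n * τ t) + |s| * (t + τ t) := by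
    rw [← sub_mul, abs_mul, mul_comm, ← mul_add]
    refine mul_le_mul_of_nonneg_left ?_ (abs_nonneg s)
    rw [abs_le]
    constructor <;> nlinarith
  obtain ⟨hd1, hd2⟩ := abs_le.1 hdist
  have hsm : |s| * (n * τ t) + n * (2 * e t) ≤ ε / 4 * T := by
    have h1 := mul_le_mul_of_nonneg_left hte hn0
    have h2 := mul_le_mul_of_nonneg_left hnt (show 0 ≤ ε / 4 by positivity)
    linarith
  have hnε := mul_le_mul_of_nonneg_left hnt (show 0 ≤ ε / 4 by positivity)
  refine le_trans (Real.exp_le_exp.2 ?_) (hn.trans (h.tiltedMass_mono T 0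
    (Set.Icc_subset_Icc ?_ ?_)))
  · have := mul_le_mul_of_nonneg_left hl (T.cast_nonneg (α := ℝ))
    nlinarith
  · nlinarith
  · nlinarith

lemma isClosed_achievable (h : IsGluingFamily p f τ e) : IsClosed (achievable p f) := by
  refine isClosed_of_closure_subset fun x hx ε hε => ?_
  obtain ⟨z, hz, hxz⟩ := Metric.mem_closure_iff.1 hx (ε / 2) (half_pos hε)
  rw [Prod.dist_eq, max_lt_iff, Real.dist_eq, Real.dist_eq, abs_lt, abs_lt] at hxz
  filter_upwards [hz (ε / 2) (half_pos hε)] with T hT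
  have hT0 := T.cast_nonneg (α := ℝ)
  refine le_trans (Real.exp_le_exp.2 ?_) (hT.trans (h.tiltedMass_mono T 0
    (Set.Icc_subset_Icc ?_ ?_)))
  · exact neg_le_neg (mul_le_mul_of_nonneg_left (by linarith) hT0)
  · exact mul_le_mul_of_nonneg_left (by linarith) hT0
  · exact mul_le_mul_of_nonneg_left (by linarith) hT0

lemma mem_achievable_of_le {s y y' : ℝ} (hy : (s, y) ∈ achievable p f) (hyy : y ≤ y') :
    (s, y') ∈ achievable p f := by
  intro ε hε
  filter_upwards [hy ε hε] with T hT
  refine le_trans (Real.exp_le_exp.2 ?_) hT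
  exact neg_le_neg (mul_le_mul_of_nonneg_left (by simpa using hyy) T.cast_nonneg)

/-- Words of length `T` are glued from two words, whose lengths are in the proportion `a : b`. -/
lemma convex_achievable (h : IsGluingFamily p f τ e) : Convex ℝ (achievable p f) := by
  rw [convex_iff_forall_pos]
  rintro ⟨s₁, y₁⟩ h₁ ⟨s₂, y₂⟩ h₂ a b ha hb hab ε hε
  simp only [Prod.fst_add, Prod.snd_add, Prod.smul_fst, Prod.smul_snd, smul_eq_mul]
  -- The lengths are `k T ~ a T` and `r T ~ b T`, with the gap `τ (k T) = o(T)` between them.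
  set k : ℕ → ℕ := fun T => ⌊a * T⌋₊ with hk
  have hkT : Tendsto (fun T : ℕ => (k T : ℝ) / T) atTop (𝓝 a) :=
    (tendsto_nat_floor_mul_div_atTop ha.le).comp tendsto_natCast_atTop_atTop
  have hktop : Tendsto k atTop atTop :=
    tendsto_nat_floor_atTop.comp (tendsto_natCast_atTop_atTop.const_mul_atTop ha)
  have hcomp : ∀ {u : ℕ → ℝ}, Tendsto (fun t : ℕ => u t / t) atTop (𝓝 0) →
      Tendsto (fun T : ℕ => u (k T) / T) atTop (𝓝 0) := by
    intro u hu
    have := (hu.comp hktop).mul hkT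
    rw [zero_mul] at this
    refine this.congr' ?_
    filter_upwards [hktop.eventually_ge_atTop 1] with T hT
    have : (k T : ℝ) ≠ 0 := by positivity
    simp only [Function.comp]
    field_simp
  have hτ := hcomp h.tendsto_gap
  have hlen : ∀ᶠ T : ℕ in atTop, (k T + τ (k T) : ℝ) / T < 1 := by
    have := hkT.add hτ
    rw [add_zero] at this
    filter_upwards [this.eventually (gt_mem_nhds (show a < 1 by linarith))] with T hT
    rwa [add_div]
  set r : ℕ → ℕ := fun T => T - k T - τ (k T) with hr
  have hrT' : ∀ᶠ T : ℕ in atTop, 1 ≤ k T ∧ k T + τ (k T) + r T = T := by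
    filter_upwards [hlen, eventually_ge_atTop 1, hktop.eventually_ge_atTop 1] with T hT hT1 hk1
    have hT0 : (0 : ℝ) < T := by exact_mod_cast hT1
    rw [div_lt_one hT0] at hT
    have : k T + τ (k T) < T := by exact_mod_cast hT
    exact ⟨hk1, by simp only [hr]; omega⟩
  have hrT : Tendsto (fun T : ℕ => (r T : ℝ) / T) atTop (𝓝 b) := by
    have h3 := (tendsto_const_nhds (x := (1 : ℝ))).sub (hkT.add hτ)
    have : 1 - (a + 0) = b := by linarith
    rw [this] at h3
    refine h3.congr' ?_
    filter_upwards [hrT', eventually_ge_atTop 1] with T hT hT1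
    have hT0 : (T : ℝ) ≠ 0 := by positivity
    have : (k T : ℝ) + τ (k T) + r T = T := by exact_mod_cast hT.2
    field_simp
    linarith
  have hrtop : Tendsto r atTop atTop := by
    have := (hrT.pos_mul_atTop hb tendsto_natCast_atTop_atTop)
    rw [← tendsto_natCast_atTop_iff (R := ℝ)]
    refine this.congr' ?_
    filter_upwards [eventually_ge_atTop 1] with T hT
    have : (T : ℝ) ≠ 0 := by positivity
    field_simp
  have hlim : ∀ c d : ℝ, ∀ u : ℕ → ℝ, Tendsto (fun t : ℕ => u t / t) atTop (𝓝 0) →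
      ∀ z, a * c + b * d < z →
      ∀ᶠ T : ℕ in atTop, k T * c + r T * d + u (k T) ≤ T * z := by
    intro c d u hu z hz
    have := ((hkT.mul_const c).add (hrT.mul_const d)).add (hcomp hu)
    rw [add_zero] at this
    filter_upwards [this.eventually (gt_mem_nhds hz), eventually_ge_atTop 1] with T hT hT1
    have hT0 : (0 : ℝ) < T := by exact_mod_cast hT1
    have h4 : (k T : ℝ) / T * c + r T / T * d + u (k T) / T =
      (k T * c + r T * d + u (k T)) / T := by ring
    rw [h4, div_lt_iff₀ hT0] at hT
    linarith
  have hmix : a * (ε / 2) + b * (ε / 2) = ε / 2 := by rw [← add_mul, hab, one_mul]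
  have he2 : Tendsto (fun t : ℕ => (2 * e t) / t) atTop (𝓝 0) := by
    simpa [mul_div_assoc] using h.tendsto_error.const_mul 2
  filter_upwards [hktop.eventually (h₁ (ε / 2) (half_pos hε)),
    hrtop.eventually (h₂ (ε / 2) (half_pos hε)), hrtop.eventually_ge_atTop 1, hrT',
    hlim (y₁ + ε / 2) (y₂ + ε / 2) _ (h.tendsto_gluingDefect 0) (a * y₁ + b * y₂ + ε)
      (by linarith),
    hlim (s₁ + ε / 2) (s₂ + ε / 2) _ he2 (a * s₁ + b * s₂ + ε) (by linarith),
    hlim (-(s₁ - ε / 2)) (-(s₂ - ε / 2)) _ he2 (-(a * s₁ + b * s₂ - ε)) (by linarith)]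
    with T hp1 hp2 hr1 hT hy hup hlow
  have hglue := h.tiltedMass_glue hT.1 hr1 0
    (S := Set.Icc (k T * (s₁ - ε / 2)) (k T * (s₁ + ε / 2)))
    (S' := Set.Icc (r T * (s₂ - ε / 2)) (r T * (s₂ + ε / 2)))
    (U := Set.Icc (T * (a * s₁ + b * s₂ - ε)) (T * (a * s₁ + b * s₂ + ε))) ?_
  · rw [hT.2] at hglue
    refine le_trans ?_ hglue
    calc Real.exp (-(T * (a * y₁ + b * y₂ + ε)))
        ≤ Real.exp (-gluingDefect τ e 0 (k T)) * (Real.exp (-(k T * (y₁ + ε / 2))) *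
            Real.exp (-(r T * (y₂ + ε / 2)))) := by
          rw [← Real.exp_add, ← Real.exp_add]
          exact Real.exp_le_exp.2 (by linarith)
      _ ≤ _ := by
          gcongr
          exact h.tiltedMass_nonneg _ _ _
  · rintro x ⟨hx1, hx2⟩ y ⟨hy1, hy2⟩ z hz
    obtain ⟨hz1, hz2⟩ := abs_le.1 hz
    constructor <;> linarith

/-- Every exponential rate below the pressure at `α` is carried by the values near some `T s`, where
the observable has probability about `e^{-T (α s - l)}`: cover the compact interval of
`exists_truncation` by small intervals. -/
lemma exists_mem_achievable (h : IsGluingFamily p f τ e) {α l : ℝ}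
    (hl : (l : EReal) < pressure p f τ e α) : ∃ s, (s, α * s - l) ∈ achievable p f := by
  by_contra! hcon
  obtain ⟨l₂, hl₂, hl₂'⟩ := EReal.lt_iff_exists_real_btwn.1 hl
  rw [EReal.coe_lt_coe_iff] at hl₂
  obtain ⟨M, hM⟩ := h.exists_truncation hl₂'
  have hcov : ∃ C : ℝ, ∀ᶠ T : ℕ in atTop,
      tiltedMass p f T α {z | z / T ∈ Set.Icc (-M) M} ≤ C * Real.exp (T * l) := by
    refine isCompact_Icc.induction_on (p := fun S : Set ℝ => ∃ C : ℝ, ∀ᶠ T : ℕ in atTop,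
      tiltedMass p f T α {z | z / T ∈ S} ≤ C * Real.exp (T * l)) ?_ ?_ ?_ ?_
    · exact ⟨0, Eventually.of_forall fun T => by simp [tiltedMass]⟩
    · rintro S S' hS ⟨C, hC⟩
      refine ⟨C, ?_⟩
      filter_upwards [hC] with T hT
      refine le_trans (h.tiltedMass_mono T α ?_) hT
      exact fun z hz => hS hz
    · rintro S S' ⟨C, hC⟩ ⟨C', hC'⟩
      refine ⟨C + C', ?_⟩
      filter_upwards [hC, hC'] with T hT hT'
      rw [add_mul]
      exact (h.tiltedMass_union_le T α {z | z / T ∈ S} {z | z / T ∈ S'}).trans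
        (add_le_add hT hT')
    · intro s _
      obtain ⟨ε, hε, hev⟩ : ∃ ε > 0, ∀ᶠ T : ℕ in atTop,
          ¬ (Real.exp (-(T * (α * s - l + ε))) ≤
            tiltedMass p f T 0 (Set.Icc (T * (s - ε)) (T * (s + ε)))) := by
        by_contra! hno
        exact hcon s (h.mem_achievable_of_frequently fun ε hε => by
          simpa [Filter.Frequently] using hno ε hε)
      have hα1 : 0 < |α| + 1 := by positivity
      set δ := min ε (ε / (|α| + 1)) with hδ
      have hδ0 : 0 < δ := by positivity
      have hδα : |α| * δ ≤ ε := by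
        have : δ * (|α| + 1) ≤ ε := (le_div_iff₀ hα1).1 (min_le_right _ _)
        nlinarith
      refine ⟨Metric.ball s δ, mem_nhdsWithin_of_mem_nhds (Metric.ball_mem_nhds s hδ0), 1, ?_⟩
      filter_upwards [hev, eventually_ge_atTop 1] with T hT hT1
      have hT0 : (0 : ℝ) < T := by exact_mod_cast hT1
      push Not at hT
      have hδε : δ ≤ ε := min_le_left _ _
      have h1 : tiltedMass p f T α {z | z / T ∈ Metric.ball s δ} ≤
          Real.exp (T * (α * s + ε)) * tiltedMass p f T 0 {z | z / T ∈ Metric.ball s δ} := by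
        refine h.tiltedMass_le_exp_mul T fun z hz => ?_
        rw [Set.mem_ofPred_eq, Metric.mem_ball, Real.dist_eq] at hz
        have h2 : α * (z / T - s) ≤ ε := by
          refine (le_abs_self _).trans ?_
          rw [abs_mul]
          exact (mul_le_mul_of_nonneg_left hz.le (abs_nonneg α)).trans hδα
        have h3 : α * z = T * (α * (z / T)) := by field_simp
        rw [h3, zero_mul, zero_add]
        exact mul_le_mul_of_nonneg_left (by linarith) hT0.le
      have h2 : tiltedMass p f T 0 {z | z / T ∈ Metric.ball s δ} ≤
          tiltedMass p f T 0 (Set.Icc (T * (s - ε)) (T * (s + ε))) := by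
        refine h.tiltedMass_mono T 0 fun z hz => ?_
        rw [Set.mem_ofPred_eq, Metric.mem_ball, Real.dist_eq, abs_lt] at hz
        have h3 : z = T * (z / T) := by field_simp
        rw [h3]
        exact ⟨mul_le_mul_of_nonneg_left (by linarith) hT0.le,
          mul_le_mul_of_nonneg_left (by linarith) hT0.le⟩
      calc _ ≤ _ := h1
        _ ≤ Real.exp (T * (α * s + ε)) * Real.exp (-(T * (α * s - l + ε))) := by
          gcongr
          exact h2.trans hT.le
        _ = 1 * Real.exp (T * l) := by rw [← Real.exp_add, one_mul]; congr 1; ring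
  obtain ⟨C, hC⟩ := hcov
  have hgrow := Real.tendsto_exp_atTop.comp
    (tendsto_natCast_atTop_atTop.atTop_mul_const (sub_pos.2 hl₂))
  obtain ⟨T, hT, hT', hTC, hT1⟩ := (hM.and (hC.and
    ((hgrow.eventually_gt_atTop C).and (eventually_ge_atTop 1)))).exists
  have hT0 : (0 : ℝ) < T := by exact_mod_cast hT1
  have hsub : Set.Icc ((T : ℝ) * -M) (T * M) ⊆ {z | z / T ∈ Set.Icc (-M) M} := by
    rintro z ⟨hz1, hz2⟩
    exact ⟨(le_div_iff₀ hT0).2 (by linarith), (div_le_iff₀ hT0).2 (by linarith)⟩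
  have h1 := hT.trans ((h.tiltedMass_mono T α hsub).trans hT')
  have h2 : Real.exp (T * l₂) = Real.exp (T * (l₂ - l)) * Real.exp (T * l) := by
    rw [← Real.exp_add]; congr 1; ring
  rw [h2] at h1
  exact absurd (le_of_mul_le_mul_right h1 (Real.exp_pos _)) (not_le.2 hTC)

end IsGluingFamily

end Abstract

/-! ### The Fenchel-Legendre transform -/

lemma coe_sub_le_coe_iff (a y : ℝ) (q : EReal) (hq : q ≠ ⊥) :
    (a : EReal) - q ≤ y ↔ ((a - y : ℝ) : EReal) ≤ q := by
  induction q with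
  | bot => exact absurd rfl hq
  | top => simp
  | coe q =>
    rw [← EReal.coe_sub, EReal.coe_le_coe_iff, EReal.coe_le_coe_iff]
    constructor <;> intro h <;> linarith

lemma fenchelLegendre_le_coe_iff {q : ℝ → EReal} (hq : ∀ α, q α ≠ ⊥) (s y : ℝ) :
    fenchelLegendre q s ≤ y ↔ ∀ α, ((α * s - y : ℝ) : EReal) ≤ q α := by
  simp only [fenchelLegendre, iSup_le_iff]
  exact forall_congr' fun α => coe_sub_le_coe_iff _ _ _ (hq α)

lemma lowerSemicontinuous_fenchelLegendre {q : ℝ → EReal} (hq : ∀ α, q α ≠ ⊥) :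
    LowerSemicontinuous (fenchelLegendre q) := by
  refine lowerSemicontinuous_iSup fun α => ?_
  rcases eq_or_ne (q α) ⊤ with htop | htop
  · simpa [htop] using lowerSemicontinuous_const
  · lift q α to ℝ using ⟨htop, hq α⟩ with c
    refine Continuous.lowerSemicontinuous ?_
    simp only [← EReal.coe_sub]
    exact continuous_coe_real_ereal.comp (by fun_prop)

lemma isConvexFun_fenchelLegendre {q : ℝ → EReal} (hq : ∀ α, q α ≠ ⊥) :
    IsConvexFun (fenchelLegendre q) := by
  rintro ⟨s, x⟩ hx ⟨t, y⟩ hy a b ha hb hab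
  rw [Set.mem_ofPred_eq, fenchelLegendre_le_coe_iff hq] at hx hy ⊢
  intro α
  simp only [Prod.fst_add, Prod.snd_add, Prod.smul_fst, Prod.smul_snd, smul_eq_mul]
  refine EReal.le_of_forall_lt_iff_le.1 fun z hz => ?_
  have h1 := (hx α).trans hz.le
  have h2 := (hy α).trans hz.le
  rw [EReal.coe_le_coe_iff] at h1 h2 ⊢
  have h3 := mul_le_mul_of_nonneg_left h1 ha
  have h4 := mul_le_mul_of_nonneg_left h2 hb
  have h5 : a * z + b * z = z := by rw [← add_mul, hab, one_mul]
  linarith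

lemma fenchelLegendre_nonneg {q : ℝ → EReal} (hq : q 0 = 0) (s : ℝ) :
    0 ≤ fenchelLegendre q s := by
  refine le_trans ?_ (le_iSup _ (0 : ℝ))
  simp [hq]

lemma isCompact_fenchelLegendre_le {q : ℝ → EReal} (hq : ∀ α, q α ≠ ⊥)
    (hfin : ∀ᶠ α in 𝓝 (0 : ℝ), q α ≠ ⊤) (a : ℝ) :
    IsCompact {s | fenchelLegendre q s ≤ (a : EReal)} := by
  obtain ⟨δ, hδ, hball⟩ := Metric.eventually_nhds_iff.1 hfin
  have hhalf : ∀ α, |α| = δ / 2 → ∃ c : ℝ, q α = c := fun α hα =>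
    ⟨(q α).toReal, (EReal.coe_toReal (hball (by rw [Real.dist_eq, sub_zero, hα]; linarith))
      (hq α)).symm⟩
  obtain ⟨c, hc⟩ := hhalf (δ / 2) (abs_of_pos (half_pos hδ))
  obtain ⟨c', hc'⟩ := hhalf (-(δ / 2)) (by rw [abs_neg, abs_of_pos (half_pos hδ)])
  refine (isCompact_Icc (a := -((a + c') / (δ / 2))) (b := (a + c) / (δ / 2))).of_isClosed_subset
    ((lowerSemicontinuous_fenchelLegendre hq).isClosed_preimage _) fun s hs => ?_
  rw [Set.mem_ofPred_eq, fenchelLegendre_le_coe_iff hq] at hs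
  have h1 := hs (δ / 2)
  have h2 := hs (-(δ / 2))
  rw [hc, EReal.coe_le_coe_iff] at h1
  rw [hc', EReal.coe_le_coe_iff] at h2
  constructor
  · rw [neg_le, le_div_iff₀ (half_pos hδ)]; linarith
  · rw [le_div_iff₀ (half_pos hδ)]; linarith

/-- The symmetry of the transform, from that of the function. -/
lemma fenchelLegendre_neg {q : ℝ → EReal} (hq : ∀ α, q α ≠ ⊥)
    (hsymm : ∀ α, q (-α) = q (α - 1)) (s : ℝ) :
    fenchelLegendre q (-s) = fenchelLegendre q s + (s : EReal) := by
  have key : ∀ y : ℝ, fenchelLegendre q (-s) ≤ y ↔ fenchelLegendre q s ≤ ((y - s : ℝ) : EReal) := by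
    intro y
    rw [fenchelLegendre_le_coe_iff hq, fenchelLegendre_le_coe_iff hq]
    constructor
    · intro h α
      have := h (-(α + 1))
      rw [hsymm (α + 1), add_sub_cancel_right] at this
      convert this using 2
      ring
    · intro h α
      have := h (-α - 1)
      rw [← hsymm (-α), neg_neg] at this
      convert this using 2
      ring
  have hle : ∀ x : EReal, ∀ y : ℝ, x + (s : EReal) ≤ y ↔ x ≤ ((y - s : ℝ) : EReal) := by
    intro x y
    induction x with
    | bot => simp
    | top => simp [-EReal.coe_sub]
    | coe x =>
      rw [← EReal.coe_add, EReal.coe_le_coe_iff, EReal.coe_le_coe_iff]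
      constructor <;> intro h <;> linarith
  refine le_antisymm (EReal.le_of_forall_lt_iff_le.1 fun z hz => ?_)
    (EReal.le_of_forall_lt_iff_le.1 fun z hz => ?_)
  · exact (key z).2 ((hle _ z).1 hz.le)
  · exact (hle _ z).2 ((key z).1 hz.le)

/-! ### Logarithmic rates -/

lemma coe_le_log_div {T : ℕ} (hT : 1 ≤ T) {z x : ℝ} (h : Real.exp (T * z) ≤ x) :
    (z : EReal) ≤ ENNReal.log (ENNReal.ofReal x) / (T : EReal) := by
  have hT0 : (0 : EReal) < T := by exact_mod_cast hT
  rw [EReal.le_div_iff_mul_le hT0 (EReal.natCast_ne_top T)]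
  refine le_trans (le_of_eq ?_) (ENNReal.log_le_log_iff.2 (ENNReal.ofReal_le_ofReal h))
  rw [ENNReal.log_ofReal_of_pos (Real.exp_pos _), Real.log_exp, mul_comm]
  rfl

lemma log_div_le_coe {T : ℕ} (hT : 1 ≤ T) {z x : ℝ} (h : x ≤ Real.exp (T * z)) :
    ENNReal.log (ENNReal.ofReal x) / (T : EReal) ≤ z := by
  have hT0 : (0 : EReal) < T := by exact_mod_cast hT
  rw [EReal.div_le_iff_le_mul hT0 (EReal.natCast_ne_top T)]
  refine (ENNReal.log_le_log_iff.2 (ENNReal.ofReal_le_ofReal h)).trans (le_of_eq ?_)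
  rw [ENNReal.log_ofReal_of_pos (Real.exp_pos _), Real.log_exp]
  rfl

section Abstract

variable {W : ℕ → Type*} [∀ t, Fintype (W t)]

namespace IsGluingFamily

variable {p f : ∀ t, W t → ℝ} {τ : ℕ → ℕ} {e : ℕ → ℝ}

/-! ### The achievable rates and the transform of the pressure -/

lemma achievable_nonneg (h : IsGluingFamily p f τ e) {s y : ℝ} (hsy : (s, y) ∈ achievable p f) :
    0 ≤ y := by
  refine le_of_forall_pos_le_add fun ε hε => ?_
  obtain ⟨T, hT, hT1⟩ := ((hsy ε hε).and (eventually_ge_atTop 1)).exists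
  have hT0 : (0 : ℝ) < T := by exact_mod_cast hT1
  have := hT.trans (h.tiltedMass_zero_le_one T _)
  rw [Real.exp_le_one_iff, neg_nonpos] at this
  exact nonneg_of_mul_nonneg_right this hT0

/-- Chebyshev's inequality. -/
lemma fenchelLegendre_le_of_mem_achievable (h : IsGluingFamily p f τ e) {s y : ℝ}
    (hsy : (s, y) ∈ achievable p f) : fenchelLegendre (pressure p f τ e) s ≤ y := by
  rw [fenchelLegendre_le_coe_iff pressure_ne_bot]
  intro α
  refine EReal.ge_of_forall_gt_iff_ge.1 fun z hz => ?_
  rw [EReal.coe_lt_coe_iff] at hz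
  have hα1 : 0 < |α| + 1 := by positivity
  set ε := (α * s - y - z) / (|α| + 1) with hε
  have hε0 : 0 < ε := div_pos (sub_pos.2 hz) hα1
  have hεz : |α| * ε + ε = α * s - y - z := by rw [hε]; field_simp
  refine ge_of_tendsto (h.tendsto_pressure α) ?_
  filter_upwards [hsy ε hε0, eventually_ge_atTop 1] with T hT hT1
  have hT0 : (0 : ℝ) < T := by exact_mod_cast hT1
  rw [EReal.coe_le_coe_iff, le_div_iff₀ hT0, Real.le_log_iff_exp_le (h.tiltedMass_univ_pos T α)]
  have h1 : tiltedMass p f T 0 (Set.Icc (T * (s - ε)) (T * (s + ε))) ≤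
      Real.exp (-(T * (α * s - |α| * ε))) *
        tiltedMass p f T α (Set.Icc (T * (s - ε)) (T * (s + ε))) := by
    refine h.tiltedMass_le_exp_mul T fun x hx => ?_
    have h2 : |x - T * s| ≤ T * ε := abs_le.2 ⟨by linarith [hx.1], by linarith [hx.2]⟩
    have h3 : |α * (x - T * s)| ≤ |α| * (T * ε) := by
      rw [abs_mul]; exact mul_le_mul_of_nonneg_left h2 (abs_nonneg α)
    linarith [neg_abs_le (α * (x - T * s))]
  have h2 := hT.trans (h1.trans (mul_le_mul_of_nonneg_left
    (h.tiltedMass_mono T α (Set.subset_univ _)) (Real.exp_pos _).le))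
  rw [Real.exp_neg (T * (α * s - |α| * ε)), ← div_eq_inv_mul, le_div_iff₀ (Real.exp_pos _),
    ← Real.exp_add] at h2
  refine le_trans (le_of_eq ?_) h2
  congr 1
  linear_combination (T : ℝ) * hεz

/-- A point of the epigraph of the transform of the pressure is achievable: otherwise a line
separates it from the closed convex set of the achievable points, and the slope of the line is
a tilt that contradicts `exists_mem_achievable`. -/
lemma mem_achievable_of_fenchelLegendre_le (h : IsGluingFamily p f τ e) {s₀ y₀ : ℝ}
    (hle : fenchelLegendre (pressure p f τ e) s₀ ≤ y₀) : (s₀, y₀) ∈ achievable p f := by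
  rw [fenchelLegendre_le_coe_iff pressure_ne_bot] at hle
  by_contra hnot
  obtain ⟨φ, u, hu, hG⟩ := geometric_hahn_banach_point_closed h.convex_achievable
    h.isClosed_achievable hnot
  set a := φ (1, 0) with ha
  set b := φ (0, 1) with hb
  have hφ : ∀ s y, φ (s, y) = a * s + b * y := by
    intro s y
    have : ((s, y) : ℝ × ℝ) = s • ((1, 0) : ℝ × ℝ) + y • ((0, 1) : ℝ × ℝ) := by simp
    rw [this, map_add, map_smul, map_smul, smul_eq_mul, smul_eq_mul, mul_comm a, mul_comm b]
  have hG' : ∀ s y, (s, y) ∈ achievable p f → u < a * s + b * y := fun s y hsy =>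
    hφ s y ▸ hG _ hsy
  rw [hφ] at hu
  have hb0 : 0 ≤ b := by
    by_contra! hb0
    obtain ⟨s₁, hs₁⟩ := h.exists_mem_achievable (α := 0) (l := -1) (by
      rw [h.pressure_zero]; exact_mod_cast (by norm_num : (-1 : ℝ) < 0))
    set y₁ := 0 * s₁ - -1
    set k := max 0 ((u - (a * s₁ + b * y₁)) / b)
    have hk0 : 0 ≤ k := le_max_left _ _
    have h1 := hG' s₁ (y₁ + k) (mem_achievable_of_le hs₁ (by linarith))
    have h2 : (u - (a * s₁ + b * y₁)) / b ≤ k := le_max_right _ _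
    rw [div_le_iff_of_neg hb0] at h2
    linarith
  rcases hb0.eq_or_lt with hb0 | hb0
  · -- A vertical line: tilts of arbitrarily large slope are used.
    rw [← hb0, zero_mul, add_zero] at hu
    obtain ⟨K, hK0, hK⟩ : ∃ K : ℝ, 0 ≤ K ∧ y₀ + 1 < K * (u - a * s₀) := by
      have hpos := sub_pos.2 hu
      refine ⟨(|y₀| + 2) / (u - a * s₀), by positivity, ?_⟩
      rw [div_mul_cancel₀ _ hpos.ne']
      linarith [le_abs_self y₀]
    have hlt : ((-(K * a) * s₀ - y₀ - 1 : ℝ) : EReal) < pressure p f τ e (-(K * a)) :=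
      lt_of_lt_of_le (EReal.coe_lt_coe_iff.2 (by linarith)) (hle (-(K * a)))
    obtain ⟨s, hs⟩ := h.exists_mem_achievable hlt
    have h1 := hG' _ _ hs
    rw [← hb0, zero_mul, add_zero] at h1
    have h2 := h.achievable_nonneg hs
    have h3 := mul_le_mul_of_nonneg_left h1.le hK0
    linarith
  · have hlt : ((-u / b : ℝ) : EReal) < pressure p f τ e (-a / b) := by
      refine lt_of_lt_of_le (EReal.coe_lt_coe_iff.2 ?_) (hle (-a / b))
      have : -a / b * s₀ - y₀ = (-a * s₀ - b * y₀) / b := by field_simp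
      rw [this]
      exact div_lt_div_of_pos_right (by linarith) hb0
    obtain ⟨l, hl, hl'⟩ := EReal.lt_iff_exists_real_btwn.1 hlt
    rw [EReal.coe_lt_coe_iff, div_lt_iff₀ hb0] at hl
    obtain ⟨s, hs⟩ := h.exists_mem_achievable hl'
    have h1 := hG' _ _ hs
    have h2 : a * s + b * (-a / b * s - l) = -(l * b) := by field_simp; ring
    linarith

/-! ### The large deviation principle -/

/-- Chebyshev's inequality on a set which lies on one side of `x`. -/
lemma eventually_tiltedMass_le_exp (h : IsGluingFamily p f τ e) {α x z : ℝ} {S : Set ℝ}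
    (hz : (z : EReal) < ((α * x : ℝ) : EReal) - pressure p f τ e α)
    (hS : ∀ s ∈ S, α * x ≤ α * s) :
    ∀ᶠ T : ℕ in atTop, tiltedMass p f T 0 {v | v / T ∈ S} ≤ Real.exp (T * -z) := by
  have hlt : pressure p f τ e α < ((α * x - z : ℝ) : EReal) := by
    refine lt_of_not_ge fun hge => hz.not_ge ?_
    exact (coe_sub_le_coe_iff _ _ _ (pressure_ne_bot α)).2 hge
  filter_upwards [(h.tendsto_pressure α).eventually (gt_mem_nhds hlt), eventually_ge_atTop 1]
    with T hT hT1
  have hT0 : (0 : ℝ) < T := by exact_mod_cast hT1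
  rw [EReal.coe_lt_coe_iff, div_lt_iff₀ hT0,
    Real.log_lt_iff_lt_exp (h.tiltedMass_univ_pos T α)] at hT
  have h1 : tiltedMass p f T 0 {v | v / T ∈ S} ≤
      Real.exp (-(T * (α * x))) * tiltedMass p f T α {v | v / T ∈ S} := by
    refine h.tiltedMass_le_exp_mul T fun v hv => ?_
    have h2 := mul_le_mul_of_nonneg_left (hS _ hv) hT0.le
    have h3 : (T : ℝ) * (α * (v / T)) = α * v := by field_simp
    linarith
  calc _ ≤ _ := h1
    _ ≤ Real.exp (-(T * (α * x))) * Real.exp ((α * x - z) * T) := by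
      gcongr
      exact (h.tiltedMass_mono T α (Set.subset_univ _)).trans hT.le
    _ = _ := by rw [← Real.exp_add]; congr 1; ring

lemma coe_le_liminf (h : IsGluingFamily p f τ e) {s y : ℝ} (hsy : (s, y) ∈ achievable p f)
    {O : Set ℝ} (hO : IsOpen O) (hs : s ∈ O) :
    ((-y : ℝ) : EReal) ≤ liminf (fun T : ℕ =>
      ENNReal.log (ENNReal.ofReal (tiltedMass p f T 0 {v | v / T ∈ O})) / (T : EReal)) atTop := by
  refine EReal.ge_of_forall_gt_iff_ge.1 fun z hz => ?_
  rw [EReal.coe_lt_coe_iff] at hz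
  obtain ⟨δ, hδ, hball⟩ := Metric.isOpen_iff.1 hO s hs
  set ε := min (-y - z) (δ / 2) with hε
  have hε0 : 0 < ε := lt_min (by linarith) (half_pos hδ)
  refine le_liminf_of_le (by isBoundedDefault) ?_
  filter_upwards [hsy ε hε0, eventually_ge_atTop 1] with T hT hT1
  have hT0 : (0 : ℝ) < T := by exact_mod_cast hT1
  refine coe_le_log_div hT1 (le_trans (Real.exp_le_exp.2 ?_)
    (hT.trans (h.tiltedMass_mono T 0 ?_)))
  · rw [← mul_neg]
    exact mul_le_mul_of_nonneg_left (by linarith [min_le_left (-y - z) (δ / 2)]) hT0.le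
  · rintro v ⟨hv1, hv2⟩
    refine hball ?_
    rw [Metric.mem_ball, Real.dist_eq, abs_lt]
    have h1 : s - ε ≤ v / T := (le_div_iff₀ hT0).2 (by linarith)
    have h2 : v / T ≤ s + ε := (div_le_iff₀ hT0).2 (by linarith)
    have h3 : ε ≤ δ / 2 := min_le_right _ _
    constructor <;> linarith

/-- The upper bound holds for all closed sets, bounded or not. A sublevel set of the transform is
an interval, and a closed set that avoids it is covered by two half-lines. -/
lemma limsup_le (h : IsGluingFamily p f τ e) {Γ : Set ℝ} (hΓ : IsClosed Γ) {z : ℝ}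
    (hz : (z : EReal) < ⨅ s ∈ Γ, fenchelLegendre (pressure p f τ e) s) :
    limsup (fun T : ℕ =>
      ENNReal.log (ENNReal.ofReal (tiltedMass p f T 0 {v | v / T ∈ Γ})) / (T : EReal)) atTop ≤
      ((-z : ℝ) : EReal) := by
  refine limsup_le_of_le (by isBoundedDefault) ?_
  rcases le_or_gt z 0 with hz0 | hz0
  · filter_upwards [eventually_ge_atTop 1] with T hT1
    refine log_div_le_coe hT1 ((h.tiltedMass_zero_le_one T _).trans (Real.one_le_exp ?_))
    exact mul_nonneg T.cast_nonneg (by linarith)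
  obtain ⟨z', hzz, hz'⟩ := EReal.lt_iff_exists_real_btwn.1 hz
  rw [EReal.coe_lt_coe_iff] at hzz
  -- The infimum of the transform is zero, so that its sublevel set at `z' > 0` is not empty.
  obtain ⟨s₀, hs₀⟩ := h.exists_mem_achievable (α := 0) (l := -z') (by
    rw [h.pressure_zero]; exact_mod_cast (by linarith : -z' < 0))
  have hI₀ := h.fenchelLegendre_le_of_mem_achievable hs₀
  rw [zero_mul, zero_sub, neg_neg, fenchelLegendre_le_coe_iff pressure_ne_bot] at hI₀
  have hIΓ : ∀ x ∈ Γ, ∃ α : ℝ,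
      (z' : EReal) < ((α * x : ℝ) : EReal) - pressure p f τ e α ∧ 0 < α * (x - s₀) := by
    intro x hx
    obtain ⟨α, hα⟩ := lt_iSup_iff.1 (hz'.trans_le (iInf₂_le x hx))
    refine ⟨α, hα, ?_⟩
    by_contra! hneg
    refine hα.not_ge ((coe_sub_le_coe_iff _ _ _ (pressure_ne_bot α)).2 (le_trans ?_ (hI₀ α)))
    rw [EReal.coe_le_coe_iff]
    linarith
  have hright : ∀ᶠ T : ℕ in atTop,
      tiltedMass p f T 0 {v | v / T ∈ Γ ∩ Set.Ici s₀} ≤ Real.exp (T * -z') := by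
    rcases (Γ ∩ Set.Ici s₀).eq_empty_or_nonempty with hE | hE
    · rw [hE]
      exact Eventually.of_forall fun T => by simp [tiltedMass, Real.exp_nonneg]
    have hbdd : BddBelow (Γ ∩ Set.Ici s₀) := ⟨s₀, fun x hx => hx.2⟩
    have hmem := (hΓ.inter isClosed_Ici).csInf_mem hE hbdd
    obtain ⟨α, hα, hpos⟩ := hIΓ _ hmem.1
    have hα0 : 0 < α := pos_of_mul_pos_left hpos (sub_nonneg.2 hmem.2)
    exact h.eventually_tiltedMass_le_exp hα fun s hs =>
      mul_le_mul_of_nonneg_left (csInf_le hbdd hs) hα0.le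
  have hleft : ∀ᶠ T : ℕ in atTop,
      tiltedMass p f T 0 {v | v / T ∈ Γ ∩ Set.Iic s₀} ≤ Real.exp (T * -z') := by
    rcases (Γ ∩ Set.Iic s₀).eq_empty_or_nonempty with hE | hE
    · rw [hE]
      exact Eventually.of_forall fun T => by simp [tiltedMass, Real.exp_nonneg]
    have hbdd : BddAbove (Γ ∩ Set.Iic s₀) := ⟨s₀, fun x hx => hx.2⟩
    have hmem := (hΓ.inter isClosed_Iic).csSup_mem hE hbdd
    obtain ⟨α, hα, hpos⟩ := hIΓ _ hmem.1
    have hα0 : α < 0 := neg_of_mul_pos_left hpos (sub_nonpos.2 hmem.2)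
    exact h.eventually_tiltedMass_le_exp hα fun s hs =>
      mul_le_mul_of_nonpos_left (le_csSup hbdd hs) hα0.le
  filter_upwards [hright, hleft, eventually_ge_atTop 1,
    eventually_const_le_mul (Real.log 2) (sub_pos.2 hzz)] with T h1 h2 hT1 hT2
  refine log_div_le_coe hT1 ?_
  have hcov : {v : ℝ | v / T ∈ Γ} ⊆
      {v | v / T ∈ Γ ∩ Set.Ici s₀} ∪ {v | v / T ∈ Γ ∩ Set.Iic s₀} := fun v hv =>
    (le_total s₀ (v / T)).imp (fun hle => ⟨hv, hle⟩) fun hle => ⟨hv, hle⟩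
  calc tiltedMass p f T 0 {v | v / T ∈ Γ}
      ≤ Real.exp (T * -z') + Real.exp (T * -z') :=
        ((h.tiltedMass_mono T 0 hcov).trans (h.tiltedMass_union_le T 0 _ _)).trans
          (add_le_add h1 h2)
    _ = Real.exp (Real.log 2 + T * -z') := by
        rw [Real.exp_add, Real.exp_log two_pos]; ring
    _ ≤ Real.exp (T * -z) := Real.exp_le_exp.2 (by linarith)

/-- The large deviation principle for random variables `Y t / t`, where `Y t` has the law of
the observable `f t`. -/
lemma satisfiesLDP (h : IsGluingFamily p f τ e) {Ω : Type*} [MeasurableSpace Ω] {P : Measure Ω}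
    {Y : ℕ → Ω → ℝ}
    (hlaw : ∀ t S, P {ω | Y t ω ∈ S} = ENNReal.ofReal (tiltedMass p f t 0 S)) :
    SatisfiesLDP P (fun t ω => Y t ω / t) (fenchelLegendre (pressure p f τ e)) where
  isRateFunction := ⟨fenchelLegendre_nonneg h.pressure_zero,
    lowerSemicontinuous_fenchelLegendre pressure_ne_bot⟩
  lower_bound O hO := by
    have hset : ∀ t : ℕ, P {ω | Y t ω / t ∈ O} =
        ENNReal.ofReal (tiltedMass p f t 0 {v | v / t ∈ O}) := fun t => hlaw t {v | v / t ∈ O}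
    simp only [hset]
    refine EReal.neg_le.1 (le_iInf₂ fun s hs => EReal.le_of_forall_lt_iff_le.1 fun y hy => ?_)
    refine EReal.neg_le.1 ?_
    exact h.coe_le_liminf (h.mem_achievable_of_fenchelLegendre_le hy.le) hO hs
  upper_bound Γ hΓ := by
    have hset : ∀ t : ℕ, P {ω | Y t ω / t ∈ Γ} =
        ENNReal.ofReal (tiltedMass p f t 0 {v | v / t ∈ Γ}) := fun t => hlaw t {v | v / t ∈ Γ}
    simp only [hset]
    refine EReal.le_neg_of_le_neg (EReal.ge_of_forall_gt_iff_ge.1 fun z hz => ?_)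
    exact EReal.le_neg_of_le_neg (h.limsup_le hΓ hz)

end IsGluingFamily

end Abstract

section Words

variable {A : Type*}

/-! ### Probabilities of words -/

lemma exists_ofFn_eq {l : List A} {n : ℕ} (hl : l.length = n) : ∃ w : Fin n → A, List.ofFn w = l := by
  subst hl
  exact ⟨l.get, List.ofFn_get l⟩

lemma wordCylinder_ofFn {t : ℕ} (w : Fin t → A) :
    wordCylinder (List.ofFn w) = (fun (ω : ℕ → A) (i : Fin t) => ω i) ⁻¹' {w} := by
  ext ω
  simp only [wordCylinder, Set.mem_ofPred_eq, List.length_ofFn, List.getElem_ofFn,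
    Set.mem_preimage, Set.mem_singleton_iff, funext_iff]
  exact ⟨fun h i => h i i.2, fun h i hi => h ⟨i, hi⟩⟩

lemma wordCylinder_cons_subset (a : A) (w : List A) :
    wordCylinder (a :: w) ⊆ shift ⁻¹' wordCylinder w := by
  intro ω hω i hi
  exact hω (i + 1) (by simpa using hi)

lemma IsInvolutionFamily.involutive {θ : ∀ t : ℕ, (Fin t → A) → (Fin t → A)}
    (hθ : IsInvolutionFamily θ) (t : ℕ) : Function.Involutive (θ t) := by
  obtain ⟨u, hu, hθ | hθ⟩ := hθ
  · intro w
    simp [hθ, hu _]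
  · intro w
    simp [hθ, hu _]

variable [MeasurableSpace A]

lemma wordProb_nonneg (Q : Measure (ℕ → A)) (w : List A) : 0 ≤ wordProb Q w := measureReal_nonneg

lemma measurable_firstLetters (t : ℕ) : Measurable fun (ω : ℕ → A) (i : Fin t) => ω i :=
  measurable_pi_lambda _ fun _ => measurable_pi_apply _

instance isProbabilityMeasure_marginal (Q : Measure (ℕ → A)) [IsProbabilityMeasure Q] (t : ℕ) :
    IsProbabilityMeasure (marginal Q t) :=
  Measure.isProbabilityMeasure_map (measurable_firstLetters t).aemeasurable

variable [MeasurableSingletonClass A]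

lemma marginal_singleton (Q : Measure (ℕ → A)) [IsProbabilityMeasure Q] {t : ℕ} (w : Fin t → A) :
    marginal Q t {w} = ENNReal.ofReal (wordProb Q (List.ofFn w)) := by
  rw [wordProb, wordCylinder_ofFn, ofReal_measureReal, marginal,
    Measure.map_apply (measurable_firstLetters t) (measurableSet_singleton w)]

lemma wordProb_ofFn (Q : Measure (ℕ → A)) [IsProbabilityMeasure Q] {t : ℕ} (w : Fin t → A) :
    wordProb Q (List.ofFn w) = (marginal Q t {w}).toReal := by
  rw [marginal_singleton, ENNReal.toReal_ofReal (wordProb_nonneg _ _)]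

lemma measurableSet_wordCylinder (w : List A) : MeasurableSet (wordCylinder w) := by
  obtain ⟨v, hv⟩ := exists_ofFn_eq (l := w) rfl
  rw [← hv, wordCylinder_ofFn]
  exact measurable_firstLetters _ (measurableSet_singleton v)

lemma sum_wordProb [Fintype A] (Q : Measure (ℕ → A)) [IsProbabilityMeasure Q] (t : ℕ) :
    ∑ w : Fin t → A, wordProb Q (List.ofFn w) = 1 := by
  simp only [wordProb_ofFn]
  rw [← ENNReal.toReal_sum (fun _ _ => measure_ne_top _ _),
    sum_measure_singleton, Finset.coe_univ, measure_univ, ENNReal.toReal_one]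

lemma wordProb_cons_le {Q : Measure (ℕ → A)} [IsProbabilityMeasure Q]
    (hQ : MeasurePreserving shift Q Q) (a : A) (w : List A) :
    wordProb Q (a :: w) ≤ wordProb Q w := by
  have : Q.real (shift ⁻¹' wordCylinder w) = Q.real (wordCylinder w) := by
    rw [measureReal_def, hQ.measure_preimage (measurableSet_wordCylinder w).nullMeasurableSet]
    rfl
  exact (measureReal_mono (wordCylinder_cons_subset a w)).trans_eq this

lemma wordProb_append_le {Q : Measure (ℕ → A)} [IsProbabilityMeasure Q]
    (hQ : MeasurePreserving shift Q Q) (x w : List A) :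
    wordProb Q (x ++ w) ≤ wordProb Q w := by
  induction x with
  | nil => simp
  | cons a x ih => exact (wordProb_cons_le hQ a (x ++ w)).trans ih

lemma wordProb_pos_of_absolutelyContinuous {P P' : Measure (ℕ → A)} [IsProbabilityMeasure P]
    [IsProbabilityMeasure P'] (hac : ∀ t : ℕ, marginal P t ≪ marginal P' t) {w : List A}
    (hw : 0 < wordProb P w) : 0 < wordProb P' w := by
  obtain ⟨v, hv⟩ := exists_ofFn_eq (l := w) rfl
  rw [← hv] at hw ⊢
  refine (wordProb_nonneg _ _).lt_of_ne' fun h0 => hw.ne' ?_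
  have : marginal P' _ {v} = 0 := by rw [marginal_singleton, h0, ENNReal.ofReal_zero]
  rw [wordProb_ofFn, hac _ this, ENNReal.toReal_zero]

/-! ### The law of the entropy production -/

/-- The entropy production of a word, `log (P(w) / P'(w))`. -/
noncomputable def wordEntropy (P P' : Measure (ℕ → A)) (w : List A) : ℝ :=
  Real.log (wordProb P w / wordProb P' w)

lemma llr_marginal {P P' : Measure (ℕ → A)} [IsProbabilityMeasure P] [IsProbabilityMeasure P']
    (hac : ∀ t : ℕ, marginal P t ≪ marginal P' t) {t : ℕ} {w : Fin t → A}
    (hw : 0 < wordProb P (List.ofFn w)) :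
    llr (marginal P t) (marginal P' t) w = wordEntropy P P' (List.ofFn w) := by
  have hw' := wordProb_pos_of_absolutelyContinuous hac hw
  have h1 : (marginal P t).rnDeriv (marginal P' t) w * marginal P' t {w} = marginal P t {w} := by
    conv_rhs => rw [← Measure.withDensity_rnDeriv_eq _ _ (hac t),
      withDensity_apply _ (measurableSet_singleton w), lintegral_singleton]
  have h2 := congrArg ENNReal.toReal h1
  rw [ENNReal.toReal_mul, ← wordProb_ofFn, ← wordProb_ofFn] at h2
  rw [llr, wordEntropy, ← h2, mul_div_cancel_right₀ _ hw'.ne']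

lemma lintegral_entropyProduction [Fintype A] {P P' : Measure (ℕ → A)} [IsProbabilityMeasure P]
    [IsProbabilityMeasure P'] (hac : ∀ t : ℕ, marginal P t ≪ marginal P' t) (t : ℕ)
    (g : ℝ → ℝ≥0∞) :
    ∫⁻ ω, g (entropyProduction P P' t ω) ∂P = ∑ w : Fin t → A,
      ENNReal.ofReal (wordProb P (List.ofFn w)) * g (wordEntropy P P' (List.ofFn w)) := by
  have hmap : ∫⁻ ω, g (entropyProduction P P' t ω) ∂P =
      ∫⁻ w, g (llr (marginal P t) (marginal P' t) w) ∂(marginal P t) :=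
    (lintegral_map (f := fun w => g (llr (marginal P t) (marginal P' t) w))
      Measurable.of_discrete (measurable_firstLetters t)).symm
  rw [hmap, lintegral_fintype]
  refine Finset.sum_congr rfl fun w _ => ?_
  rw [marginal_singleton, mul_comm]
  rcases (wordProb_nonneg P (List.ofFn w)).eq_or_lt with h0 | h0
  · simp [← h0]
  · rw [llr_marginal hac h0]

lemma lintegral_exp_entropyProduction [Fintype A] {P P' : Measure (ℕ → A)}
    [IsProbabilityMeasure P] [IsProbabilityMeasure P']
    (hac : ∀ t : ℕ, marginal P t ≪ marginal P' t) (t : ℕ) (α : ℝ) :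
    ∫⁻ ω, ENNReal.ofReal (Real.exp (α * entropyProduction P P' t ω)) ∂P =
      ENNReal.ofReal (tiltedMass (W := fun t => Fin t → A) (fun _ w => wordProb P (List.ofFn w))
        (fun _ w => wordEntropy P P' (List.ofFn w)) t α Set.univ) := by
  rw [lintegral_entropyProduction hac t fun x => ENNReal.ofReal (Real.exp (α * x)), tiltedMass,
    ENNReal.ofReal_sum_of_nonneg fun w _ => mul_nonneg (wordProb_nonneg _ _) (by
      simpa using (Real.exp_pos _).le)]
  refine Finset.sum_congr rfl fun w _ => ?_
  rw [ENNReal.ofReal_mul (wordProb_nonneg _ _), Set.indicator_univ]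

lemma measure_entropyProduction_mem [Fintype A] {P P' : Measure (ℕ → A)}
    [IsProbabilityMeasure P] [IsProbabilityMeasure P']
    (hac : ∀ t : ℕ, marginal P t ≪ marginal P' t) (t : ℕ) (S : Set ℝ) :
    P {ω | entropyProduction P P' t ω ∈ S} =
      ENNReal.ofReal (tiltedMass (W := fun t => Fin t → A) (fun _ w => wordProb P (List.ofFn w))
        (fun _ w => wordEntropy P P' (List.ofFn w)) t 0 S) := by
  classical
  have hmeas : MeasurableSet {ω | entropyProduction P P' t ω ∈ S} :=
    measurable_firstLetters t (Set.toFinite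
      {w | llr (marginal P t) (marginal P' t) w ∈ S}).measurableSet
  rw [← lintegral_indicator_one hmeas]
  have hind : ∀ ω, {ω | entropyProduction P P' t ω ∈ S}.indicator (1 : (ℕ → A) → ℝ≥0∞) ω =
      S.indicator (1 : ℝ → ℝ≥0∞) (entropyProduction P P' t ω) := fun ω => rfl
  simp only [hind]
  rw [lintegral_entropyProduction hac t (S.indicator 1), tiltedMass,
    ENNReal.ofReal_sum_of_nonneg fun w _ => mul_nonneg (wordProb_nonneg _ _)
      (IsGluingFamily.indicator_exp_nonneg _ _ _)]
  refine Finset.sum_congr rfl fun w _ => ?_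
  rw [ENNReal.ofReal_mul (wordProb_nonneg _ _)]
  by_cases hw : wordEntropy P P' (List.ofFn w) ∈ S
  · simp [Set.indicator_of_mem hw]
  · simp [Set.indicator_of_notMem hw]

/-! ### Gluing words to an exact length -/

/-- Some letter can be put in front of any word at the cost of a constant factor: of the word
`a ξ v` that decoupling provides for a fixed letter `a`, keep `v` and the letter before it. -/
lemma exists_cons [Finite A] {P P' : Measure (ℕ → A)} [IsProbabilityMeasure P] [IsProbabilityMeasure P']
    (hP : MeasurePreserving shift P P) (hP' : MeasurePreserving shift P' P')
    (hac : ∀ t : ℕ, marginal P t ≪ marginal P' t) (hSSD : SelectiveSymmetricDecoupling P P') :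
    ∃ δ : ℝ, 0 < δ ∧ δ ≤ 1 ∧ ∀ v : List A, 1 ≤ v.length →
      ∃ a : A, ∀ Q ∈ ({P, P'} : Set (Measure (ℕ → A))), δ * wordProb Q v ≤ wordProb Q (a :: v) := by
  obtain ⟨τ, c, -, -, -, hdec⟩ := hSSD
  obtain ⟨b, hb⟩ : ∃ b : A, 0 < wordProb P [b] := by
    by_contra! hcon
    cases nonempty_fintype A
    have h1 := sum_wordProb P 1
    have h2 : ∑ w : Fin 1 → A, wordProb P (List.ofFn w) ≤ 0 :=
      Finset.sum_nonpos fun w _ => by simpa using hcon (w 0)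
    linarith
  have hb' := wordProb_pos_of_absolutelyContinuous hac hb
  have hQb : ∀ Q ∈ ({P, P'} : Set (Measure (ℕ → A))),
      min (wordProb P [b]) (wordProb P' [b]) ≤ wordProb Q [b] := by
    rintro Q (rfl | rfl)
    · exact min_le_left _ _
    · exact min_le_right _ _
  have hmono : ∀ Q ∈ ({P, P'} : Set (Measure (ℕ → A))), ∀ x v : List A,
      wordProb Q (x ++ v) ≤ wordProb Q v := by
    rintro Q (rfl | rfl)
    · exact wordProb_append_le hP
    · exact wordProb_append_le hP'
  refine ⟨min 1 (Real.exp (-c 1) * min (wordProb P [b]) (wordProb P' [b])),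
    lt_min one_pos (mul_pos (Real.exp_pos _) (lt_min hb hb')), min_le_left _ _, fun v hv => ?_⟩
  obtain ⟨ξ, -, hξ⟩ := hdec 1 le_rfl [b] v rfl hv
  have hne : [b] ++ ξ ≠ [] := by simp
  refine ⟨([b] ++ ξ).getLast hne, fun Q hQ => ?_⟩
  calc min 1 (Real.exp (-c 1) * min (wordProb P [b]) (wordProb P' [b])) * wordProb Q v
      ≤ (Real.exp (-c 1) * wordProb Q [b]) * wordProb Q v := by
        refine mul_le_mul_of_nonneg_right ((min_le_right _ _).trans ?_) (wordProb_nonneg _ _)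
        exact mul_le_mul_of_nonneg_left (hQb Q hQ) (Real.exp_pos _).le
    _ ≤ wordProb Q ([b] ++ ξ ++ v) := by rw [mul_assoc]; exact (hξ Q hQ).1
    _ = wordProb Q (([b] ++ ξ).dropLast ++ (([b] ++ ξ).getLast hne :: v)) := by
        congr 1
        conv_lhs => rw [← List.dropLast_append_getLast hne]
        simp
    _ ≤ _ := hmono Q hQ _ _

/-- Padding a word on the left, at an exponential cost in the number of the added letters. -/
lemma exists_pad [Finite A] {P P' : Measure (ℕ → A)} [IsProbabilityMeasure P] [IsProbabilityMeasure P']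
    (hP : MeasurePreserving shift P P) (hP' : MeasurePreserving shift P' P')
    (hac : ∀ t : ℕ, marginal P t ≪ marginal P' t) (hSSD : SelectiveSymmetricDecoupling P P') :
    ∃ D : ℝ, 0 ≤ D ∧ ∀ (k : ℕ) (v : List A), 1 ≤ v.length → ∃ x : List A, x.length = k ∧
      ∀ Q ∈ ({P, P'} : Set (Measure (ℕ → A))),
        Real.exp (-(D * k)) * wordProb Q v ≤ wordProb Q (x ++ v) := by
  obtain ⟨δ, hδ0, hδ1, hδ⟩ := exists_cons hP hP' hac hSSD
  refine ⟨-Real.log δ, neg_nonneg.2 (Real.log_nonpos hδ0.le hδ1), fun k v hv => ?_⟩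
  have hexp : Real.exp (-(-Real.log δ * k)) = δ ^ k := by
    rw [neg_mul, neg_neg, mul_comm, Real.exp_nat_mul, Real.exp_log hδ0]
  rw [hexp]
  induction k with
  | zero => exact ⟨[], rfl, by simp⟩
  | succ k ih =>
    obtain ⟨x, hx, hxQ⟩ := ih (by rw [neg_mul, neg_neg, mul_comm, Real.exp_nat_mul,
      Real.exp_log hδ0])
    obtain ⟨a, ha⟩ := hδ (x ++ v) (by simp; omega)
    refine ⟨a :: x, by simp [hx], fun Q hQ => ?_⟩
    rw [pow_succ', mul_assoc]
    exact (mul_le_mul_of_nonneg_left (hxQ Q hQ) hδ0.le).trans (ha Q hQ)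

/-- Decoupling with letters added on both sides of `u`, whose total number `τ t` depends only on
the length `t` of `u`. -/
lemma exists_exact_decoupling [Finite A] {P P' : Measure (ℕ → A)} [IsProbabilityMeasure P]
    [IsProbabilityMeasure P'] (hP : MeasurePreserving shift P P)
    (hP' : MeasurePreserving shift P' P') (hac : ∀ t : ℕ, marginal P t ≪ marginal P' t)
    (hSSD : SelectiveSymmetricDecoupling P P') :
    ∃ (τ : ℕ → ℕ) (e : ℕ → ℝ), (∀ t, 0 ≤ e t) ∧
      Tendsto (fun t : ℕ => e t / t) atTop (𝓝 0) ∧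
      Tendsto (fun t : ℕ => (τ t : ℝ) / t) atTop (𝓝 0) ∧
      ∀ t : ℕ, 1 ≤ t → ∀ u v : List A, u.length = t → 1 ≤ v.length →
        ∃ x ξ : List A, x.length + ξ.length = τ t ∧
          ∀ Q ∈ ({P, P'} : Set (Measure (ℕ → A))),
            Real.exp (-e t) * (wordProb Q u * wordProb Q v) ≤ wordProb Q (x ++ (u ++ (ξ ++ v))) ∧
            wordProb Q (x ++ (u ++ (ξ ++ v))) ≤ Real.exp (e t) * (wordProb Q u * wordProb Q v) := by
  obtain ⟨D, hD0, hD⟩ := exists_pad hP hP' hac hSSD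
  obtain ⟨τ, c, hc0, hc, hτ, hdec⟩ := hSSD
  refine ⟨τ, fun t => c t + D * τ t, fun t => add_nonneg (hc0 t) (by positivity), ?_, hτ,
    fun t ht u v hu hv => ?_⟩
  · have := hc.add (hτ.const_mul D)
    rw [mul_zero, add_zero] at this
    exact this.congr fun t => by ring
  · obtain ⟨ξ, hξ, hξQ⟩ := hdec t ht u v hu hv
    obtain ⟨x, hx, hxQ⟩ := hD (τ t - ξ.length) (u ++ ξ ++ v) (by simp; omega)
    refine ⟨x, ξ, by omega, fun Q hQ => ?_⟩
    have hassoc : u ++ (ξ ++ v) = u ++ ξ ++ v := (List.append_assoc _ _ _).symm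
    rw [hassoc]
    have hlow := hxQ Q hQ
    obtain ⟨h1, h2⟩ := hξQ Q hQ
    have huv : 0 ≤ wordProb Q u * wordProb Q v :=
      mul_nonneg (wordProb_nonneg _ _) (wordProb_nonneg _ _)
    have hk : D * ((τ t - ξ.length : ℕ) : ℝ) ≤ D * τ t :=
      mul_le_mul_of_nonneg_left (by exact_mod_cast Nat.sub_le _ _) hD0
    constructor
    · calc Real.exp (-(c t + D * τ t)) * (wordProb Q u * wordProb Q v)
          = Real.exp (-(D * τ t)) * (Real.exp (-c t) * (wordProb Q u * wordProb Q v)) := by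
            rw [← mul_assoc (Real.exp (-(D * τ t))), ← Real.exp_add]; congr 2; ring
        _ ≤ Real.exp (-(D * ((τ t - ξ.length : ℕ) : ℝ))) * wordProb Q (u ++ ξ ++ v) := by
            gcongr
        _ ≤ _ := hlow
    · have hmono : wordProb Q (x ++ (u ++ ξ ++ v)) ≤ wordProb Q (u ++ ξ ++ v) := by
        rcases hQ with rfl | rfl
        · exact wordProb_append_le hP _ _
        · exact wordProb_append_le hP' _ _
      refine hmono.trans (h2.trans (mul_le_mul_of_nonneg_right (Real.exp_le_exp.2 ?_) huv))
      have : 0 ≤ D * τ t := by positivity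
      linarith

lemma abs_log_sub_le {x y z e : ℝ} (hx : 0 < x) (hy : 0 < y)
    (h1 : Real.exp (-e) * (x * y) ≤ z) (h2 : z ≤ Real.exp e * (x * y)) :
    |Real.log z - Real.log x - Real.log y| ≤ e := by
  have hxy := mul_pos hx hy
  have hz : 0 < z := (mul_pos (Real.exp_pos _) hxy).trans_le h1
  have h3 := Real.log_le_log (mul_pos (Real.exp_pos _) hxy) h1
  have h4 := Real.log_le_log hz h2
  rw [Real.log_mul (Real.exp_pos _).ne' hxy.ne', Real.log_mul hx.ne' hy.ne', Real.log_exp] at h3 h4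
  rw [abs_le]
  constructor <;> linarith

/-- Selective symmetric decoupling makes the words of length `t`, with their probabilities and
their entropy production, a gluing family. -/
lemma exists_isGluingFamily [Fintype A] {P P' : Measure (ℕ → A)} [IsProbabilityMeasure P]
    [IsProbabilityMeasure P'] (hP : MeasurePreserving shift P P)
    (hP' : MeasurePreserving shift P' P') (hac : ∀ t : ℕ, marginal P t ≪ marginal P' t)
    (hSSD : SelectiveSymmetricDecoupling P P') :
    ∃ (τ : ℕ → ℕ) (e : ℕ → ℝ), IsGluingFamily (W := fun t => Fin t → A)
      (fun _ w => wordProb P (List.ofFn w)) (fun _ w => wordEntropy P P' (List.ofFn w)) τ e := by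
  obtain ⟨τ, e, he0, he, hτ, hdec⟩ := exists_exact_decoupling hP hP' hac hSSD
  refine ⟨τ, e, ⟨fun _ _ => wordProb_nonneg _ _, sum_wordProb P, he0, he, hτ,
    fun t s ht hs => ?_⟩⟩
  have hdec' := fun (u : Fin t → A) (v : Fin s → A) =>
    hdec t ht (List.ofFn u) (List.ofFn v) (by simp) (by simpa using hs)
  choose x ξ hlen hQ using hdec'
  have hword : ∀ u v, ∃ w : Fin (t + τ t + s) → A,
      List.ofFn w = x u v ++ (List.ofFn u ++ (ξ u v ++ List.ofFn v)) := fun u v =>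
    exists_ofFn_eq (by have := hlen u v; simp; omega)
  choose w hw using hword
  refine ⟨fun y => (w y.1 y.2, ⟨(x y.1 y.2).length, by have := hlen y.1 y.2; omega⟩), ?_, ?_⟩
  · rintro ⟨u, v⟩ ⟨u', v'⟩ heq
    simp only [Prod.mk.injEq, Fin.mk.injEq] at heq
    obtain ⟨hww, hx⟩ := heq
    have happ := congrArg List.ofFn hww
    rw [hw, hw] at happ
    have h1 := (List.append_inj happ hx).2
    have h2 := List.append_inj h1 (by simp)
    have h3 := (List.append_inj h2.2 (by have := hlen u v; have := hlen u' v'; omega)).2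
    rw [List.ofFn_injective h2.1, List.ofFn_injective h3]
  · intro u v hu hv
    obtain ⟨hlow, hup⟩ := hQ u v P (by simp)
    obtain ⟨hlow', hup'⟩ := hQ u v P' (by simp)
    have hu' := wordProb_pos_of_absolutelyContinuous hac hu
    have hv' := wordProb_pos_of_absolutelyContinuous hac hv
    have hpos := (mul_pos (Real.exp_pos (-e t)) (mul_pos hu hv)).trans_le hlow
    have hpos' := (mul_pos (Real.exp_pos (-e t)) (mul_pos hu' hv')).trans_le hlow'
    simp only [hw]
    refine ⟨hlow, ?_⟩
    have h1 := abs_le.1 (abs_log_sub_le hu hv hlow hup)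
    have h2 := abs_le.1 (abs_log_sub_le hu' hv' hlow' hup')
    simp only [wordEntropy]
    rw [Real.log_div hpos.ne' hpos'.ne', Real.log_div hu.ne' hu'.ne',
      Real.log_div hv.ne' hv'.ne', abs_le]
    constructor <;> linarith [h1.1, h1.2, h2.1, h2.2]

/-! ### The entropic pressure at `-1` and its symmetry -/

lemma tiltedMass_neg_one_le_one [Fintype A] {P P' : Measure (ℕ → A)} [IsProbabilityMeasure P]
    [IsProbabilityMeasure P'] (hac : ∀ t : ℕ, marginal P t ≪ marginal P' t) (t : ℕ) :
    tiltedMass (W := fun t => Fin t → A) (fun _ w => wordProb P (List.ofFn w))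
      (fun _ w => wordEntropy P P' (List.ofFn w)) t (-1) Set.univ ≤ 1 := by
  refine le_trans (Finset.sum_le_sum fun w _ => ?_) (sum_wordProb P' t).le
  simp only [Set.indicator_univ]
  rcases (wordProb_nonneg P (List.ofFn w)).eq_or_lt with h0 | h0
  · rw [← h0, zero_mul]
    exact wordProb_nonneg _ _
  · have h0' := wordProb_pos_of_absolutelyContinuous hac h0
    rw [wordEntropy, neg_one_mul, Real.exp_neg, Real.exp_log (div_pos h0 h0'), inv_div,
      mul_div_cancel₀ _ h0.ne']

/-- The change of variables `θ t` exchanges the two measures. -/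
lemma tiltedMass_symm [Fintype A] {P P' : Measure (ℕ → A)} [IsProbabilityMeasure P]
    [IsProbabilityMeasure P'] (hac : ∀ t : ℕ, marginal P t ≪ marginal P' t)
    {θ : ∀ t : ℕ, (Fin t → A) → (Fin t → A)} (hθ : IsInvolutionFamily θ)
    (hT : IsTransformOf θ P' P) (t : ℕ) (α : ℝ) :
    tiltedMass (W := fun t => Fin t → A) (fun _ w => wordProb P (List.ofFn w))
      (fun _ w => wordEntropy P P' (List.ofFn w)) t (-α) Set.univ =
    tiltedMass (W := fun t => Fin t → A) (fun _ w => wordProb P (List.ofFn w))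
      (fun _ w => wordEntropy P P' (List.ofFn w)) t (α - 1) Set.univ := by
  have hinv := hθ.involutive t
  have h1 : ∀ w, wordProb P (List.ofFn (θ t w)) = wordProb P' (List.ofFn w) := fun w => by
    rw [wordProb_ofFn, wordProb_ofFn, hT t w]
  have h2 : ∀ w, wordProb P' (List.ofFn (θ t w)) = wordProb P (List.ofFn w) := fun w => by
    rw [← h1, hinv w]
  unfold tiltedMass
  rw [← Equiv.sum_comp (hinv.toPerm (θ t))]
  refine Finset.sum_congr rfl fun w _ => ?_
  simp only [Function.Involutive.coe_toPerm, Set.indicator_univ, wordEntropy, h1, h2]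
  rcases (wordProb_nonneg P (List.ofFn w)).eq_or_lt with h0 | h0
  · -- As `P'(θ w) = P(w) = 0`, absolute continuity gives `P'(w) = P(θ w) = 0`.
    have h0' : wordProb P' (List.ofFn w) = 0 := by
      by_contra hne
      have hpos : 0 < wordProb P (List.ofFn (θ t w)) := by
        rw [h1]; exact (wordProb_nonneg _ _).lt_of_ne' hne
      have := wordProb_pos_of_absolutelyContinuous hac hpos
      rw [h2, ← h0] at this
      exact lt_irrefl _ this
    rw [← h0, h0', zero_mul, zero_mul]
  · have h0' := wordProb_pos_of_absolutelyContinuous hac h0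
    rw [Real.log_div h0.ne' h0'.ne', Real.log_div h0'.ne' h0.ne']
    conv_lhs => rw [← Real.exp_log h0', Real.log_exp, ← Real.exp_add]
    conv_rhs => rw [← Real.exp_log h0, Real.log_exp, ← Real.exp_add]
    congr 1
    ring

end Words

end SymbolicLDP

theorem theorem2p2 {A : Type*} [Finite A] [MeasurableSpace A] [MeasurableSingletonClass A]
    (P P' : Measure (ℕ → A)) [IsProbabilityMeasure P] [IsProbabilityMeasure P']
    (hP : MeasurePreserving shift P P) (hP' : MeasurePreserving shift P' P')
    (hac : ∀ t : ℕ, marginal P t ≪ marginal P' t)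
    (hSSD : SelectiveSymmetricDecoupling P P') :
    ∃ q I : ℝ → EReal,
      -- the entropic pressure exists as a limit, and is a closed proper convex function
      (∀ α : ℝ, Tendsto
        (fun t : ℕ =>
          ENNReal.log (∫⁻ ω, ENNReal.ofReal (Real.exp (α * entropyProduction P P' t ω)) ∂P)
            / (t : EReal))
        atTop (𝓝 (q α))) ∧
      IsClosedProperConvex q ∧
      q 0 = 0 ∧ q (-1) ≤ 0 ∧ (∀ α ∈ Set.Icc (-1 : ℝ) 0, q α ≤ 0) ∧
      -- the large deviation principle, with a convex rate function that is the transform of `q`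
      SatisfiesLDP P (fun t ω => entropyProduction P P' t ω / t) I ∧
      IsConvexFun I ∧
      (∀ s : ℝ, I s = fenchelLegendre q s) ∧
      -- goodness
      ((∀ᶠ α in 𝓝 (0 : ℝ), q α ≠ ⊤) → IsGoodRateFunction I) ∧
      -- the symmetries
      (∀ θ : ∀ t : ℕ, (Fin t → A) → (Fin t → A), IsInvolutionFamily θ → IsTransformOf θ P' P →
        (∀ α : ℝ, q (-α) = q (α - 1)) ∧ (∀ s : ℝ, I (-s) = I s + (s : EReal))) := by
  cases nonempty_fintype A
  obtain ⟨τ, e, h⟩ := exists_isGluingFamily hP hP' hac hSSD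
  set p : ∀ t, (Fin t → A) → ℝ := fun _ w => wordProb P (List.ofFn w)
  set f : ∀ t, (Fin t → A) → ℝ := fun _ w => wordEntropy P P' (List.ofFn w)
  set q := pressure p f τ e with hq
  have hbot : ∀ α, q α ≠ ⊥ := IsGluingFamily.pressure_ne_bot
  have hLDP := h.satisfiesLDP (measure_entropyProduction_mem hac)
  have hneg : q (-1) ≤ 0 := le_of_tendsto' (h.tendsto_pressure (-1)) fun T =>
    EReal.coe_nonpos.2 (div_nonpos_of_nonpos_of_nonneg
      (Real.log_nonpos (h.tiltedMass_nonneg _ _ _) (tiltedMass_neg_one_le_one hac T))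
      T.cast_nonneg)
  refine ⟨q, fenchelLegendre q, fun α => ?_, ⟨h.isConvexFun_pressure,
    h.lowerSemicontinuous_pressure, hbot, 0, by simp [hq, h.pressure_zero]⟩, h.pressure_zero, hneg,
    fun α hα => ?_, hLDP, isConvexFun_fenchelLegendre hbot, fun s => rfl,
    fun hfin => ⟨hLDP.isRateFunction, isCompact_fenchelLegendre_le hbot hfin⟩, fun θ hθ hT => ?_⟩
  · refine (h.tendsto_pressure α).congr fun t => ?_
    rw [lintegral_exp_entropyProduction hac, ENNReal.log_ofReal_of_pos (h.tiltedMass_univ_pos t α),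
      EReal.coe_div, EReal.coe_natCast]
  · have := h.isConvexFun_pressure (x := (-1, 0)) (by simpa using hneg) (y := (0, 0))
      (by simp [h.pressure_zero]) (neg_nonneg.2 hα.2) (by linarith [hα.1] : (0 : ℝ) ≤ 1 + α)
      (by ring)
    simpa using this
  · have hsymm : ∀ α, q (-α) = q (α - 1) := fun α =>
      tendsto_nhds_unique (h.tendsto_pressure (-α)) <| by
        simpa only [tiltedMass_symm hac hθ hT, p, f] using h.tendsto_pressure (α - 1)
    exact ⟨hsymm, fenchelLegendre_neg hbot hsymm⟩
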